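/- Let $p$ be a prime and write $\mathbb{Z}/p^\infty=\mathbb{Z}[1/p]/\mathbb{Z}$. A group $G$ is discrete $p$-toral if it has a normal subgroup $G_0\cong(\mathbb{Z}/p^\infty)^k$ for some $k\ge 0$ such that $G/G_0$ is a finite $p$-group; its order is $|G|=(k,|G/G_0|)\in\mathbb{N}^2$, and orders are compared lexicographically. A fusion system $\mathcal{F}$ over a discrete $p$-toral group $S$ is a category whose objects are the subgroups of $S$ and whose morphisms $P\to Q$ are injective group homomorphisms, including all those induced by conjugation by elements of $S$, such that every morphism is an isomorphism of $\mathcal{F}$ followed by an inclusion. Write $\mathrm{Aut}_{\mathcal{F}}(P)$ for the group of $\mathcal{F}$-automorphisms of $P$, $\mathrm{Out}_{\mathcal{F}}(P)=\mathrm{Aut}_{\mathcal{F}}(P)/\mathrm{Inn}(P)$, $\mathrm{Aut}_S(P)$ for the group of automorphisms of $P$ induced by conjugation in $S$, $\mathrm{Out}_S(P)=\mathrm{Aut}_S(P)/\mathrm{Inn}(P)$, and $c_g(x)=gxg^{-1}$. A subgroup $P\le S$ is fully centralized (resp. fully normalized) if $|C_S(P)|\ge|C_S(P')|$ (resp. $|N_S(P)|\ge|N_S(P')|$)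 for every $P'\le S$ that is isomorphic to $P$ in $\mathcal{F}$. The fusion system $\mathcal{F}$ is saturated if: (I) for every fully normalized $P\le S$, $P$ is fully centralized, $\mathrm{Out}_{\mathcal{F}}(P)$ is finite, and $\mathrm{Out}_S(P)$ is a Sylow $p$-subgroup of $\mathrm{Out}_{\mathcal{F}}(P)$; (II) for all $P\le S$ and $\varphi\in\mathrm{Hom}_{\mathcal{F}}(P,S)$ with $\varphi(P)$ fully centralized, $\varphi$ extends to some $\bar\varphi\in\mathrm{Hom}_{\mathcal{F}}(N_\varphi,S)$, where $N_\varphi=\{g\in N_S(P)\mid \varphi c_g\varphi^{-1}\in\mathrm{Aut}_S(\varphi(P))\}$; (III) if $P_1\le P_2\le\cdots$ are subgroups of $S$ with union $P_\infty$ and $\varphi\colon P_\infty\to S$ is a homomorphism with $\varphi|_{P_n}\in\mathrm{Hom}_{\mathcal{F}}(P_n,S)$ for all $n$, then $\varphi\in\mathrm{Hom}_{\mathcal{F}}(P_\infty,S)$. **Theorem.** Let $\mathcal{F}$ be a saturated fusion system over a discrete $p$-toral group $S$. Then there exists a faithful finite-dimensional complex unitary representation $\rho\colon S\to U(n)$,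 for some $n$, which is fusion-preserving ($\mathcal{F}$-invariant): for every $P\le S$ and every $f\in\mathrm{Hom}_{\mathcal{F}}(P,S)$, the representations $\rho|_P$ and $\rho|_{f(P)}\circ f$ of $P$ are isomorphic. -/

import Mathlib

/-! ### Discrete `p`-toral groups -/

/-- The group `ℤ/p^∞ ≅ ℤ[1/p]/ℤ`, realized as the union of the cyclic subgroups of order `p ^ n`
in `ℝ/ℤ`, that is, the classes of the rationals `a / p ^ n`. -/
def PruferGroup (p : ℕ) : AddSubgroup UnitAddCircle where
  carrier := {x | ∃ n : ℕ, p ^ n • x = 0}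
  zero_mem' := ⟨0, smul_zero _⟩
  add_mem' := by
    rintro x y ⟨m, hm⟩ ⟨n, hn⟩
    refine ⟨m + n, ?_⟩
    rw [smul_add, pow_add, mul_smul, mul_smul, hn, smul_zero, add_zero, ← mul_smul, mul_comm,
      mul_smul, hm, smul_zero]
  neg_mem' := by
    rintro x ⟨n, hn⟩
    exact ⟨n, by rw [smul_neg, hn, neg_zero]⟩

/-- `G` is a discrete `p`-toral group of order `(k, m)`: there is a normal subgroup `G₀` (the
identity component) isomorphic to `(ℤ/p^∞)^k` such that `G / G₀` is a finite `p`-group with `m`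
elements. -/
def HasPToralOrder (p : ℕ) (G : Type*) [Group G] (k m : ℕ) : Prop :=
  ∃ G₀ : Subgroup G, ∃ _ : G₀.Normal,
    Nonempty (G₀ ≃* Multiplicative (Fin k → PruferGroup p)) ∧
      Finite (G ⧸ G₀) ∧ IsPGroup p (G ⧸ G₀) ∧ Nat.card (G ⧸ G₀) = m

/-- `G` is a discrete `p`-toral group. -/
def IsDiscretePToral (p : ℕ) (G : Type*) [Group G] : Prop :=
  ∃ k m : ℕ, HasPToralOrder p G k m

/-- The comparison `|G| ≤ |H|` of the orders of discrete `p`-toral groups, in the lexicographic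
ordering of `ℕ × ℕ`. (The order of a discrete `p`-toral group is unique.) -/
def PToralOrderLE (p : ℕ) (G H : Type*) [Group G] [Group H] : Prop :=
  ∃ k m k' m' : ℕ, HasPToralOrder p G k m ∧ HasPToralOrder p H k' m' ∧
    (k < k' ∨ k = k' ∧ m ≤ m')

/-! ### Fusion systems -/

/-- A fusion system over a group `S`: a category whose objects are the subgroups of `S` and whose
morphisms `P → Q` are injective homomorphisms, among them all those induced by conjugation by an
element of `S` (so the identities and the inclusions, given by conjugation by `1`), such that every
morphism is an isomorphism of the category followed by an inclusion. -/
structure FusionSystem (S : Type*) [Group S] where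
  /-- The set of morphisms from `P` to `Q`. -/
  Hom (P Q : Subgroup S) : Set (P →* Q)
  comp_mem : ∀ {P Q R : Subgroup S} {φ : P →* Q} {ψ : Q →* R},
    φ ∈ Hom P Q → ψ ∈ Hom Q R → ψ.comp φ ∈ Hom P R
  conj_mem : ∀ {P Q : Subgroup S} (φ : P →* Q),
    (∃ g : S, ∀ x : P, (φ x : S) = g * x * g⁻¹) → φ ∈ Hom P Q
  injective : ∀ {P Q : Subgroup S} {φ : P →* Q}, φ ∈ Hom P Q → Function.Injective φ
  factor : ∀ {P Q : Subgroup S} {φ : P →* Q}, φ ∈ Hom P Q →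
    ∃ (R : Subgroup S) (hR : R ≤ Q) (e : P ≃* R),
      e.toMonoidHom ∈ Hom P R ∧ e.symm.toMonoidHom ∈ Hom R P ∧
        φ = (Subgroup.inclusion hR).comp e.toMonoidHom

/-- The subgroup `Aut_S(P)` of the automorphisms of `P` induced by conjugation in `S`. -/
def conjAut {S : Type*} [Group S] (P : Subgroup S) : Subgroup (MulAut P) where
  carrier := {e | ∃ g : S, ∀ x : P, (e x : S) = g * x * g⁻¹}
  one_mem' := ⟨1, fun x => by simp⟩
  mul_mem' := by
    rintro a b ⟨g, hg⟩ ⟨h, hh⟩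
    refine ⟨g * h, fun x => ?_⟩
    rw [MulAut.mul_apply, hg, hh]
    group
  inv_mem' := by
    rintro a ⟨g, hg⟩
    refine ⟨g⁻¹, fun x => ?_⟩
    have h := hg (a⁻¹ x)
    rw [MulAut.apply_inv_self] at h
    rw [h]
    group

/-- The inner automorphisms of a group form a normal subgroup of any group of automorphisms. -/
instance innSubgroupOfNormal {G : Type*} [Group G] (A : Subgroup (MulAut G)) :
    ((MulAut.conj : G →* MulAut G).range.subgroupOf A).Normal where
  conj_mem := by
    rintro ⟨n, hn⟩ h ⟨a, ha⟩
    rw [Subgroup.mem_subgroupOf] at h ⊢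
    obtain ⟨g, hg⟩ := h
    refine ⟨a g, ?_⟩
    change MulAut.conj g = n at hg
    change MulAut.conj (a g) = a * n * a⁻¹
    rw [← hg]
    ext x
    simp [MulAut.mul_apply]

namespace FusionSystem

variable {S : Type*} [Group S] (F : FusionSystem S)

/-- `Hom_F(P, S)`, as a set of homomorphisms `P → S`. -/
def HomS (P : Subgroup S) : Set (P →* S) :=
  {φ | (Subgroup.topEquiv.symm.toMonoidHom : S →* (⊤ : Subgroup S)).comp φ ∈ F.Hom P ⊤}

/-- `Iso_F(P, Q)`: the isomorphisms of the category `F`. -/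
def Iso (P Q : Subgroup S) : Set (P ≃* Q) :=
  {e | e.toMonoidHom ∈ F.Hom P Q ∧ e.symm.toMonoidHom ∈ F.Hom Q P}

/-- Two subgroups are `F`-conjugate if they are isomorphic in `F`. -/
def IsConjugate (P Q : Subgroup S) : Prop := (F.Iso P Q).Nonempty

/-- `Aut_F(P) = Iso_F(P, P)`, as a group under composition. -/
def aut (P : Subgroup S) : Subgroup (MulAut P) where
  carrier := F.Iso P P
  one_mem' := ⟨F.conj_mem _ ⟨1, fun x => by simp⟩, F.conj_mem _ ⟨1, fun x => by simp [MulAut.one_def]⟩⟩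
  mul_mem' := fun ha hb => ⟨F.comp_mem hb.1 ha.1, F.comp_mem ha.2 hb.2⟩
  inv_mem' := fun ha => ⟨ha.2, ha.1⟩

/-- `Out_F(P) = Aut_F(P) / Inn(P)`. -/
abbrev Out (P : Subgroup S) : Type _ :=
  F.aut P ⧸ (MulAut.conj : P →* MulAut P).range.subgroupOf (F.aut P)

/-- `Out_S(P) = Aut_S(P) / Inn(P)`, as a subgroup of `Out_F(P)`: the image of `Aut_S(P)`, which is
contained in `Aut_F(P)`. -/
def outS (P : Subgroup S) : Subgroup (F.Out P) :=
  ((conjAut P).subgroupOf (F.aut P)).map (QuotientGroup.mk' _)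

/-- `P` is fully centralized in `F`. -/
def FullyCentralized (p : ℕ) (P : Subgroup S) : Prop :=
  ∀ P' : Subgroup S, F.IsConjugate P P' →
    PToralOrderLE p (Subgroup.centralizer (P' : Set S)) (Subgroup.centralizer (P : Set S))

/-- `P` is fully normalized in `F`. -/
def FullyNormalized (p : ℕ) (P : Subgroup S) : Prop :=
  ∀ P' : Subgroup S, F.IsConjugate P P' →
    PToralOrderLE p (Subgroup.normalizer (P' : Set S)) (Subgroup.normalizer (P : Set S))

/-- The subgroup `N_φ` of the `g ∈ N_S(P)` such that `φ ∘ c_g ∘ φ⁻¹` is an automorphism of `φ(P)`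
induced by conjugation by an element `h` of `S`, that is, `φ (g x g⁻¹) = h φ(x) h⁻¹` for all
`x ∈ P`. -/
def extender {P : Subgroup S} (φ : P →* S) : Subgroup S where
  carrier := {g | g ∈ Subgroup.normalizer (P : Set S) ∧
    ∃ h : S, ∀ x y : P, (y : S) = g * x * g⁻¹ → φ y = h * φ x * h⁻¹}
  one_mem' := ⟨one_mem _, 1, fun x y hxy => by
    have : y = x := Subtype.ext (by simpa using hxy)
    simp [this]⟩
  mul_mem' := by
    rintro a b ⟨ha, h, hh⟩ ⟨hb, k, hk⟩
    refine ⟨mul_mem ha hb, h * k, fun x y hxy => ?_⟩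
    have hz : b * (x : S) * b⁻¹ ∈ P := (Subgroup.mem_normalizer_iff.mp hb x).mp x.2
    rw [hh ⟨_, hz⟩ y (by rw [hxy]; group), hk x ⟨_, hz⟩ rfl]
    group
  inv_mem' := by
    rintro a ⟨ha, h, hh⟩
    refine ⟨inv_mem ha, h⁻¹, fun x y hxy => ?_⟩
    rw [hh y x (by rw [hxy]; group)]
    group

theorem le_extender {P : Subgroup S} (φ : P →* S) : P ≤ extender φ := by
  intro g hg
  refine ⟨Subgroup.le_normalizer hg, φ ⟨g, hg⟩, fun x y hxy => ?_⟩
  have : y = ⟨g, hg⟩ * x * ⟨g, hg⟩⁻¹ := Subtype.ext hxy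
  rw [this, map_mul, map_mul, map_inv]

/-- The saturation axioms, for a fusion system over a discrete `p`-toral group. -/
structure IsSaturated (p : ℕ) : Prop where
  sylow : ∀ P : Subgroup S, F.FullyNormalized p P →
    F.FullyCentralized p P ∧ Finite (F.Out P) ∧
      ∃ Q : Sylow p (F.Out P), (Q : Subgroup (F.Out P)) = F.outS P
  extension : ∀ (P : Subgroup S) (φ : P →* S), φ ∈ F.HomS P → F.FullyCentralized p φ.range →
    ∃ ψ ∈ F.HomS (extender φ), ψ.comp (Subgroup.inclusion (le_extender φ)) = φ
  continuity : ∀ (P : ℕ → Subgroup S), Monotone P → ∀ φ : (⨆ n, P n : Subgroup S) →* S,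
    (∀ n, φ.comp (Subgroup.inclusion (le_iSup P n)) ∈ F.HomS (P n)) → φ ∈ F.HomS (⨆ n, P n)

/-- A complex representation `ρ` of `S` is `F`-invariant (fusion-preserving) if for every
`P ≤ S` and every `f ∈ Hom_F(P, S)` the representations `ρ|_P` and `ρ|_{f(P)} ∘ f` of `P` are
isomorphic. -/
def IsInvariant {V : Type*} [AddCommGroup V] [Module ℂ V] (ρ : Representation ℂ S V) : Prop :=
  ∀ (P : Subgroup S) (f : P →* S), f ∈ F.HomS P →
    Nonempty (Representation.Equiv (ρ.comp P.subtype : Representation ℂ P V)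
      (ρ.comp f : Representation ℂ P V))

end FusionSystem

/-! Let `T` be the identity component of `S` and `W = Aut_F(T)`, a finite group. A representation
induced from `T` has character zero off `T`. So it suffices to find a faithful `W`-invariant sum `θ`
of characters of `T` that vanishes at every `z ∈ T` conjugate in `F` to an element outside `T`. The
induced character is then `|S/T| θ` on `T` and zero elsewhere; it is constant on `F`-conjugacy
classes, because `W` controls fusion in `T` (`exists_mulAut_eq`). As `S` is locally finite, equal
characters give isomorphic representations (`nonempty_equiv_of_char_eq_of_locallyFinite`).

The crux is `exists_notMem_range_of_conj`. Suppose `x ∉ T` is conjugate to `z ∈ T`, and let the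
power `q` of `p` kill `S/T`. The norm `N = ∏ c_xⁱ`, `i < q`, has a divisible image in `T`,
centralized by `x`, which contains `N(x^q) = x^(q²)` but not `x`. Extending morphisms to
centralizers carries `N(T)` to a subgroup `E ≤ T` with `z ∉ E` and `z^(q²) ∈ E`. Since `W` is
finite, only finitely many `E` occur. Each is divisible, so the `q²`-torsion of `T/E` lifts to the
finite `q²`-torsion of `T`, and finitely many characters `χ` suffice to make some `χ(z)` a
nontrivial `q²`-th root of unity. There `1 + χ + ⋯ + χ^(q²-1)` vanishes; `θ` is the product of these
sums over all `W`-translates. -/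

open scoped IsMulCommutative

/-! ### Representations determined by their characters -/

namespace Representation

section CharacterDeterminesRep

variable {k G V W V' W' : Type*} [Field k] [Group G]
  [AddCommGroup V] [Module k V] [AddCommGroup W] [Module k W]
  [AddCommGroup V'] [Module k V'] [AddCommGroup W'] [Module k W']
  {ρ : Representation k G V} {σ : Representation k G W}
  {ρ' : Representation k G V'} {σ' : Representation k G W'}

theorem char_prod [FiniteDimensional k V] [FiniteDimensional k W] (g : G) :
    (ρ.prod σ).character g = ρ.character g + σ.character g :=
  LinearMap.trace_prodMap' (ρ g) (σ g)

/-- The product of two equivalences of representations. -/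
noncomputable def Equiv.prodCongr (e : ρ.Equiv ρ') (f : σ.Equiv σ') :
    (ρ.prod σ).Equiv (ρ'.prod σ') :=
  Equiv.mk (e.toLinearEquiv.prodCongr f.toLinearEquiv) fun g => by
    ext v
    · exact e.toIntertwiningMap.isIntertwining _ _ g v
    · simp
    · simp
    · exact f.toIntertwiningMap.isIntertwining _ _ g v

/-- A representation is the direct sum of two complementary subrepresentations. -/
noncomputable def prodEquivOfIsCompl (p q : Subrepresentation ρ)
    (h : IsCompl p.toSubmodule q.toSubmodule) :
    (p.toRepresentation.prod q.toRepresentation).Equiv ρ :=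
  Equiv.mk (Submodule.prodEquivOfIsCompl _ _ h) fun g => by
    ext v <;> simp [Subrepresentation.toRepresentation, Representation.prod]

theorem exists_isCompl_subrepresentation [Finite G] [CharZero k] (p : Subrepresentation ρ) :
    ∃ q : Subrepresentation ρ, IsCompl p.toSubmodule q.toSubmodule := by
  obtain ⟨q, hq⟩ := exists_isCompl p
  refine ⟨q, ?_, ?_⟩
  · rw [disjoint_iff]
    exact congrArg Subrepresentation.toSubmodule hq.inf_eq_bot
  · rw [codisjoint_iff]
    exact congrArg Subrepresentation.toSubmodule hq.sup_eq_top

/-- A complement of the kernel is isomorphic to the range. -/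
noncomputable def equivRangeOfIsCompl (f : IntertwiningMap ρ σ) (q : Subrepresentation ρ)
    (h : IsCompl f.ker.toSubmodule q.toSubmodule) :
    q.toRepresentation.Equiv f.range.toRepresentation :=
  IntertwiningMap.ofBijective
    (⟨(f.toLinearMap.comp q.toSubmodule.subtype).codRestrict f.range.toSubmodule
      (fun v => ⟨v, rfl⟩), fun g => by
        ext v
        exact f.isIntertwining _ _ g v⟩ :
      IntertwiningMap q.toRepresentation f.range.toRepresentation) (by
    constructor
    · intro a b hab
      have h1 : f (a : V) = f (b : V) := congrArg Subtype.val hab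
      have h2 : (a : V) - b ∈ f.ker.toSubmodule := by
        change f.toLinearMap ((a : V) - b) = 0
        rw [map_sub, sub_eq_zero]
        exact h1
      have := Submodule.disjoint_def.mp h.disjoint _ h2 (sub_mem a.2 b.2)
      exact Subtype.ext (sub_eq_zero.mp this)
    · rintro ⟨_, v, rfl⟩
      obtain ⟨a, ha, b, hb, rfl⟩ := Submodule.mem_sup.mp
        (h.sup_eq_top ▸ Submodule.mem_top : v ∈ f.ker.toSubmodule ⊔ q.toSubmodule)
      refine ⟨⟨b, hb⟩, Subtype.ext ?_⟩
      have : f.toLinearMap a = 0 := ha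
      change f.toLinearMap b = f.toLinearMap (a + b)
      rw [map_add, this, zero_add])

/-- Induction on the dimension. By orthogonality `Hom(ρ, σ)` has the dimension of `End(ρ)`, so there
is a nonzero intertwiner `f`. By Maschke both sides split off the range of `f`; what is left, the
kernel of `f` and a complement of its range, has equal characters and smaller dimension. -/
theorem nonempty_equiv_of_char_eq_aux [Finite G] [CharZero k] (n : ℕ) :
    ∀ {V : Type*} {W : Type*} [AddCommGroup V] [Module k V] [AddCommGroup W] [Module k W]
      [FiniteDimensional k V] [FiniteDimensional k W] (ρ : Representation k G V)
      (σ : Representation k G W), Module.finrank k V = n → ρ.character = σ.character →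
      Nonempty (ρ.Equiv σ) := by
  induction n using Nat.strong_induction_on with
  | _ n ih =>
  intro V W _ _ _ _ _ _ ρ σ hn hc
  have hdim : Module.finrank k V = Module.finrank k W := by
    have := congrFun hc 1
    rw [char_one, char_one] at this
    exact_mod_cast this
  rcases subsingleton_or_nontrivial V with hV | hV
  · have : Subsingleton W := by
      rw [← Module.finrank_zero_iff (R := k), ← hdim]
      exact Module.finrank_zero_of_subsingleton
    exact ⟨Equiv.mk (LinearEquiv.ofSubsingleton V W) fun g => by
      ext v; exact Subsingleton.elim _ _⟩
  cases nonempty_fintype G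
  have : Invertible (Nat.card G : k) := invertibleOfNonzero (by simp)
  have hHom : (Module.finrank k (IntertwiningMap ρ σ) : k)
      = Module.finrank k (IntertwiningMap ρ ρ) := by
    rw [← card_inv_mul_sum_char_mul_char_eq_finrank, ← card_inv_mul_sum_char_mul_char_eq_finrank,
      hc]
  have hHom' : Module.finrank k (IntertwiningMap ρ σ)
      = Module.finrank k (IntertwiningMap ρ ρ) := by exact_mod_cast hHom
  have : Nontrivial (IntertwiningMap ρ ρ) := by
    obtain ⟨v, hv⟩ := exists_ne (0 : V)
    refine ⟨⟨IntertwiningMap.id ρ, 0, fun h => hv ?_⟩⟩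
    exact congrArg (fun f : IntertwiningMap ρ ρ => f v) h
  have : Nontrivial (IntertwiningMap ρ σ) :=
    Module.nontrivial_of_finrank_pos (R := k) (by rw [hHom']; exact Module.finrank_pos)
  obtain ⟨f, hf⟩ := exists_ne (0 : IntertwiningMap ρ σ)
  obtain ⟨K, hK⟩ := exists_isCompl_subrepresentation f.ker
  obtain ⟨C, hC⟩ := exists_isCompl_subrepresentation f.range
  have e := equivRangeOfIsCompl f K hK
  have hchar : f.ker.toRepresentation.character = C.toRepresentation.character := by
    ext g
    have h1 := congrFun (char_iso (prodEquivOfIsCompl _ _ hK)) g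
    have h2 := congrFun (char_iso (prodEquivOfIsCompl _ _ hC)) g
    rw [char_prod] at h1 h2
    rw [char_iso e, hc, ← h2, add_comm] at h1
    exact add_left_cancel h1
  have hlt : Module.finrank k f.ker.toSubmodule < n := by
    rw [← hn]
    refine Submodule.finrank_lt fun h => hf ?_
    ext v
    exact (h ▸ Submodule.mem_top : v ∈ f.ker.toSubmodule)
  obtain ⟨e'⟩ := ih _ hlt f.ker.toRepresentation C.toRepresentation rfl hchar
  exact ⟨((prodEquivOfIsCompl _ _ hK).symm.trans (e'.prodCongr e)).trans
    ((Equiv.mk (LinearEquiv.prodComm k _ _) fun g => by ext <;> simp [Representation.prod]).trans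
      (prodEquivOfIsCompl _ _ hC))⟩

/-- Finite-dimensional representations of a finite group in characteristic zero are determined by
their characters. -/
theorem nonempty_equiv_of_char_eq [Finite G] [CharZero k] [FiniteDimensional k V]
    [FiniteDimensional k W] (h : ρ.character = σ.character) : Nonempty (ρ.Equiv σ) :=
  nonempty_equiv_of_char_eq_aux _ ρ σ rfl h

end CharacterDeterminesRep

section LocallyFinite

variable {k G V W : Type*} [Field k] [Group G]
  [AddCommGroup V] [Module k V] [AddCommGroup W] [Module k W]
  {ρ : Representation k G V} {σ : Representation k G W}

variable (ρ σ) in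
/-- The linear maps commuting with the action of a subgroup. -/
def commutingMaps (H : Subgroup G) : Submodule k (V →ₗ[k] W) where
  carrier := {f | ∀ g ∈ H, f ∘ₗ ρ g = σ g ∘ₗ f}
  zero_mem' := fun g _ => by simp
  add_mem' := fun ha hb g hg => by
    rw [LinearMap.add_comp, ha g hg, hb g hg, LinearMap.comp_add]
  smul_mem' := fun c f hf g hg => by
    rw [LinearMap.smul_comp, hf g hg, LinearMap.comp_smul]

theorem commutingMaps_anti {H K : Subgroup G} (h : H ≤ K) :
    commutingMaps ρ σ K ≤ commutingMaps ρ σ H := fun _ hf g hg => hf g (h hg)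

/-- Finite-dimensional representations of a locally finite group in characteristic zero are
determined by their characters. -/
theorem nonempty_equiv_of_char_eq_of_locallyFinite [CharZero k] [FiniteDimensional k V]
    [FiniteDimensional k W] (hG : ∀ s : Finset G, Finite (Subgroup.closure (s : Set G)))
    (h : ρ.character = σ.character) : Nonempty (ρ.Equiv σ) := by
  classical
  -- The commuting maps form a space that shrinks as the subgroup grows. Once its dimension is
  -- minimal, enlarging the subgroup by any `g` imposes no further condition.
  obtain ⟨s, hs⟩ : ∃ s : Finset G, ∀ t : Finset G,
      Module.finrank k (commutingMaps ρ σ (Subgroup.closure (s : Set G))) ≤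
        Module.finrank k (commutingMaps ρ σ (Subgroup.closure (t : Set G))) := by
    have := WellFounded.has_min (measure fun s : Finset G =>
      Module.finrank k (commutingMaps ρ σ (Subgroup.closure (s : Set G)))).wf Set.univ ⟨∅, Set.mem_univ _⟩
    obtain ⟨s, -, hs⟩ := this
    exact ⟨s, fun t => not_lt.mp (hs t (Set.mem_univ _))⟩
  have := hG s
  obtain ⟨e⟩ := nonempty_equiv_of_char_eq (k := k) (G := Subgroup.closure (s : Set G))
    (ρ := ρ.comp (Subgroup.subtype _)) (σ := σ.comp (Subgroup.subtype _))
    (by ext g; exact congrFun h g)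
  refine ⟨Equiv.mk e.toLinearEquiv fun g => ?_⟩
  have hle : Subgroup.closure (s : Set G) ≤ Subgroup.closure ((insert g s : Finset G) : Set G) :=
    Subgroup.closure_mono (by simp)
  have heq := Submodule.eq_of_le_of_finrank_le (commutingMaps_anti (ρ := ρ) (σ := σ) hle)
    (hs (insert g s))
  have he : (e.toLinearEquiv : V →ₗ[k] W) ∈
      commutingMaps ρ σ (Subgroup.closure (s : Set G)) := fun x hx => by
    ext v
    exact e.toIntertwiningMap.isIntertwining _ _ ⟨x, hx⟩ v
  rw [← heq] at he
  exact he g (Subgroup.subset_closure (by simp))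

end LocallyFinite

end Representation

/-! ### Structure of `p`-tori -/

/-- A `p`-torus: an abelian `p`-group that is divisible by `p` and has finitely many elements of
order `p`. -/
structure IsPTorus (p : ℕ) (A : Type*) [CommGroup A] : Prop where
  torsion : ∀ a : A, ∃ n : ℕ, a ^ p ^ n = 1
  divisible : ∀ a : A, ∃ b : A, b ^ p = a
  finite : {a : A | a ^ p = 1}.Finite

/-- Each nonempty fibre of the `p`-th power map is a coset of the finite `p`-torsion. -/
theorem finite_setOf_pow_pow_eq_one {p : ℕ} {A : Type*} [CommGroup A]
    (h : {a : A | a ^ p = 1}.Finite) (n : ℕ) : {a : A | a ^ p ^ n = 1}.Finite := by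
  induction n with
  | zero => simp
  | succ n ih =>
    have : {a : A | a ^ p ^ (n + 1) = 1} = (fun a => a ^ p) ⁻¹' {a : A | a ^ p ^ n = 1} := by
      ext a
      simp only [Set.mem_ofPred_eq, Set.mem_preimage, ← pow_mul, pow_succ']
    rw [this]
    refine ih.preimage' fun b _ => ?_
    by_cases hb : ∃ c : A, c ^ p = b
    · obtain ⟨c, rfl⟩ := hb
      refine (h.image (c * ·)).subset fun a ha => ⟨c⁻¹ * a, ?_, by simp⟩
      have ha : a ^ p = c ^ p := ha
      simp [mul_pow, ha]
    · refine Set.finite_empty.subset fun a ha => hb ⟨a, ha⟩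

namespace IsPTorus

variable {p : ℕ} {A : Type*} [CommGroup A]

theorem divisible_pow (h : IsPTorus p A) (n : ℕ) (a : A) : ∃ b : A, b ^ p ^ n = a := by
  induction n generalizing a with
  | zero => exact ⟨a, by simp⟩
  | succ n ih =>
    obtain ⟨b, rfl⟩ := h.divisible a
    obtain ⟨c, rfl⟩ := ih b
    exact ⟨c, by rw [pow_succ, pow_mul]⟩

theorem finite_pow (h : IsPTorus p A) (n : ℕ) : {a : A | a ^ p ^ n = 1}.Finite :=
  finite_setOf_pow_pow_eq_one h.finite n

theorem of_mulEquiv {B : Type*} [CommGroup B] (h : IsPTorus p A) (e : A ≃* B) : IsPTorus p B where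
  torsion b := by
    obtain ⟨n, hn⟩ := h.torsion (e.symm b)
    exact ⟨n, e.symm.injective (by simpa using hn)⟩
  divisible b := by
    obtain ⟨a, ha⟩ := h.divisible (e.symm b)
    exact ⟨e a, by rw [← map_pow, ha, e.apply_symm_apply]⟩
  finite := by
    refine (h.finite.image e).subset fun b hb => ⟨e.symm b, ?_, by simp⟩
    have hb : b ^ p = 1 := hb
    simp [← map_pow, hb]

/-- A `p`-torus is divisible by all positive integers. -/
theorem divisible_of_ne_zero (h : IsPTorus p A) (hp : p.Prime) {n : ℕ} (hn : n ≠ 0) (a : A) :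
    ∃ b : A, b ^ n = a := by
  obtain ⟨r, m, hm, rfl⟩ := Nat.exists_eq_pow_mul_and_not_dvd hn p hp.ne_one
  obtain ⟨c, rfl⟩ := h.divisible_pow r a
  obtain ⟨s, hs⟩ := h.torsion c
  have hcop : (p ^ s).Coprime m := Nat.Coprime.pow_left _ ((hp.coprime_iff_not_dvd).mpr hm)
  obtain ⟨d, hd⟩ : ∃ d : A, d ^ m = c := by
    have h1 := Nat.gcd_eq_gcd_ab (p ^ s) m
    rw [hcop.gcd_eq_one] at h1
    refine ⟨c ^ (Nat.gcdB (p ^ s) m), ?_⟩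
    have hs' : c ^ (((p ^ s : ℕ) : ℤ)) = 1 := by rw [zpow_natCast, hs]
    calc (c ^ (Nat.gcdB (p ^ s) m)) ^ m
        = c ^ ((m : ℤ) * Nat.gcdB (p ^ s) m) := by
          rw [mul_comm, zpow_mul, zpow_natCast]
      _ = c ^ (((p ^ s : ℕ) : ℤ) * Nat.gcdA (p ^ s) m + (m : ℤ) * Nat.gcdB (p ^ s) m) := by
          rw [zpow_add, zpow_mul c ((p ^ s : ℕ) : ℤ), hs', one_zpow, one_mul]
      _ = c := by rw [← h1]; simp
  exact ⟨d, by rw [mul_comm, pow_mul, hd]⟩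

end IsPTorus

theorem PruferGroup.exists_smul_eq {p : ℕ} (hp : p.Prime) (x : PruferGroup p) :
    ∃ y : PruferGroup p, p • y = x := by
  obtain ⟨⟨x⟩, n, hn⟩ := x
  refine ⟨⟨((x / p : ℝ) : UnitAddCircle), n + 1, ?_⟩, Subtype.ext ?_⟩
  · have : p • ((x / p : ℝ) : UnitAddCircle) = (x : UnitAddCircle) := by
      rw [← AddCircle.coe_nsmul]
      congr 1
      have : (p : ℝ) ≠ 0 := by exact_mod_cast hp.ne_zero
      simp; field_simp
    rw [pow_succ, mul_smul, this]
    exact hn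
  · change p • ((x / p : ℝ) : UnitAddCircle) = (x : UnitAddCircle)
    rw [← AddCircle.coe_nsmul]
    congr 1
    have : (p : ℝ) ≠ 0 := by exact_mod_cast hp.ne_zero
    simp; field_simp

theorem PruferGroup.finite_torsion {p : ℕ} (hp : p.Prime) :
    {x : PruferGroup p | p • x = 0}.Finite := by
  refine Set.Finite.of_finite_image
    ((AddCircle.finite_torsion (1 : ℝ) hp.pos).subset ?_) Subtype.val_injective.injOn
  rintro _ ⟨x, hx, rfl⟩
  exact congrArg Subtype.val hx

theorem isPTorus_pi_pruferGroup {p : ℕ} (hp : p.Prime) (k : ℕ) :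
    IsPTorus p (Multiplicative (Fin k → PruferGroup p)) where
  torsion a := by
    choose n hn using fun i => (a.toAdd i).2
    refine ⟨∑ i, n i, ?_⟩
    apply Multiplicative.toAdd.injective
    rw [toAdd_pow, toAdd_one]
    funext i
    apply Subtype.ext
    obtain ⟨c, hc⟩ := pow_dvd_pow p (Finset.single_le_sum (fun j _ => Nat.zero_le (n j))
      (Finset.mem_univ i))
    change p ^ (∑ i, n i) • ((a.toAdd i : PruferGroup p) : UnitAddCircle) = 0
    rw [hc, mul_comm, mul_smul, hn i, smul_zero]
  divisible a := by
    choose b hb using fun i => PruferGroup.exists_smul_eq hp (a.toAdd i)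
    exact ⟨Multiplicative.ofAdd b, Multiplicative.toAdd.injective (funext hb)⟩
  finite := by
    have := Set.Finite.pi (ι := Fin k) fun _ => PruferGroup.finite_torsion hp
    refine (this.image Multiplicative.ofAdd).subset fun a ha => ⟨a.toAdd, ?_, rfl⟩
    intro i _
    exact congrFun (congrArg Multiplicative.toAdd (show a ^ p = 1 from ha)) i

/-- The homomorphism `ℤ/p → ℤ/p^∞`, `1 ↦ 1/p`. -/
noncomputable def ZMod.toPrufer (p : ℕ) [NeZero p] : ZMod p →+ PruferGroup p :=
  (ZMod.toAddCircle (N := p)).codRestrict (PruferGroup p) fun x => ⟨1, by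
    rw [pow_one, ← map_nsmul]; simp⟩

theorem ZMod.toPrufer_injective (p : ℕ) [NeZero p] : Function.Injective (ZMod.toPrufer p) :=
  fun _ _ h => ZMod.toAddCircle_injective p (congrArg Subtype.val h)

theorem ZMod.exists_toPrufer_eq (p : ℕ) [NeZero p] {x : PruferGroup p} (hx : p • x = 0) :
    ∃ a, ZMod.toPrufer p a = x := by
  obtain ⟨⟨x⟩, hx'⟩ := x
  have hp : (p : ℝ) ≠ 0 := by exact_mod_cast NeZero.ne p
  have h1 : ((p • x : ℝ) : UnitAddCircle) = 0 := by
    rw [AddCircle.coe_nsmul]; exact congrArg Subtype.val hx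
  obtain ⟨m, hm⟩ := (AddCircle.coe_eq_zero_iff (1 : ℝ)).mp h1
  refine ⟨(m : ZMod p), Subtype.ext ?_⟩
  change ZMod.toAddCircle (m : ZMod p) = (x : UnitAddCircle)
  rw [ZMod.toAddCircle_intCast]
  congr 1
  simp at hm
  rw [hm]; field_simp

/-- A homomorphism defined on an abelian `p`-group is injective if it is so on the elements of
order `p`. -/
theorem injective_of_injective_on_torsion {p : ℕ} {A B : Type*} [AddCommGroup A] [AddCommGroup B]
    (hA : ∀ a : A, ∃ n : ℕ, p ^ n • a = 0) (f : A →+ B)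
    (h : ∀ a, p • a = 0 → f a = 0 → a = 0) : Function.Injective f := by
  rw [injective_iff_map_eq_zero]
  intro a ha
  obtain ⟨n, hn⟩ := hA a
  induction n with
  | zero => simpa using hn
  | succ n ih =>
    apply ih
    apply h
    · rw [← mul_smul, ← pow_succ', hn]
    · rw [map_nsmul, ha, smul_zero]

theorem surjective_of_torsion_subset_range {p : ℕ} {A B : Type*} [AddCommGroup A] [AddCommGroup B]
    (hA : ∀ a : A, ∃ a', p • a' = a) (hB : ∀ b : B, ∃ n : ℕ, p ^ n • b = 0) (f : A →+ B)
    (h : ∀ b, p • b = 0 → ∃ a, f a = b) : Function.Surjective f := by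
  intro b
  obtain ⟨n, hn⟩ := hB b
  induction n generalizing b with
  | zero => exact ⟨0, by simpa using hn.symm⟩
  | succ n ih =>
    obtain ⟨a, ha⟩ := ih (p • b) (by rw [← mul_smul, ← pow_succ, hn])
    obtain ⟨a', rfl⟩ := hA a
    obtain ⟨c, hc⟩ := h (b - f a') (by rw [smul_sub, ← ha, map_nsmul, sub_self])
    exact ⟨c + a', by rw [map_add, hc, sub_add_cancel]⟩

/-- A basis of the `p`-torsion over `ZMod p` identifies it with the `p`-torsion of `(ℤ/p^∞)^k`. The
target is divisible, hence injective, so this map extends to `A`; bijectivity of the extension can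
be tested on `p`-torsion. -/
theorem IsPTorus.exists_mulEquiv {p : ℕ} (hp : p.Prime) {A : Type*} [CommGroup A]
    (h : IsPTorus p A) : ∃ k : ℕ, Nonempty (A ≃* Multiplicative (Fin k → PruferGroup p)) := by
  have : Fact p.Prime := ⟨hp⟩
  let B := Additive A
  let K : AddSubgroup B := (nsmulAddMonoidHom p : B →+ B).ker
  have hK : ∀ x : B, x ∈ K ↔ p • x = 0 := fun x => Iff.rfl
  have : Finite K := h.finite.to_subtype
  let : Module (ZMod p) K := AddCommGroup.zmodModule (n := p) (G := K) fun x => Subtype.ext x.2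
  have : Module.Finite (ZMod p) K := Module.Finite.of_finite
  let b := Module.finBasis (ZMod p) K
  let k := Module.finrank (ZMod p) K
  let E := Fin k → PruferGroup p
  have hE : IsPTorus p (Multiplicative E) := isPTorus_pi_pruferGroup hp k
  let : DivisibleBy E ℤ := by
    have hs : ∀ n : ℕ, n ≠ 0 → Function.Surjective (fun a : E => n • a) := fun n hn a => by
      obtain ⟨c, hc⟩ := hE.divisible_of_ne_zero hp hn (Multiplicative.ofAdd a)
      exact ⟨c.toAdd, hc⟩
    let : DivisibleBy E ℕ := divisibleByOfSMulRightSurj E ℕ fun {n} hn => hs n hn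
    exact AddGroup.divisibleByIntOfDivisibleByNat E
  let g : K →+ E :=
    (AddMonoidHom.compLeft (ZMod.toPrufer p) (Fin k)).comp
      b.equivFun.toLinearMap.toAddMonoidHom
  have hg : Function.Injective g := by
    intro x y hxy
    apply b.equivFun.injective
    funext i
    exact ZMod.toPrufer_injective p (congrFun hxy i)
  obtain ⟨f, hf⟩ := (Module.Baer.of_divisible E).extension_property_addMonoidHom K.subtype
    K.subtype_injective g
  have hfg : ∀ x : K, f x = g x := fun x => DFunLike.congr_fun hf x
  have hinj : Function.Injective f := by
    refine injective_of_injective_on_torsion (p := p) (A := B) (fun a => h.torsion a) f fun a ha h0 => ?_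
    have : g ⟨a, ha⟩ = 0 := by rw [← hfg]; exact h0
    exact congrArg Subtype.val ((injective_iff_map_eq_zero g).mp hg _ this)
  have hsurj : Function.Surjective f := by
    refine surjective_of_torsion_subset_range (p := p) (A := B) (fun a => h.divisible a)
      (fun x => hE.torsion (Multiplicative.ofAdd x)) f fun x hx => ?_
    choose c hc using fun i => ZMod.exists_toPrufer_eq p (x := x i) (congrFun hx i)
    refine ⟨(b.equivFun.symm c : K), ?_⟩
    rw [hfg]
    funext i
    change ZMod.toPrufer p (b.equivFun (b.equivFun.symm c) i) = x i
    rw [LinearEquiv.apply_symm_apply, hc]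
  exact ⟨k, ⟨AddEquiv.toMultiplicativeRight (AddEquiv.ofBijective f ⟨hinj, hsurj⟩)⟩⟩

/-- An abelian `p`-group with finitely many elements of order `p` is an extension of a finite group
by a `p`-torus, which consists of the `p ^ n`-th powers for some `n`. -/
theorem exists_isPTorus_range_pow {p : ℕ} {A : Type*} [CommGroup A]
    (htor : ∀ a : A, ∃ n : ℕ, a ^ p ^ n = 1) (hfin : {a : A | a ^ p = 1}.Finite) :
    ∃ n : ℕ, IsPTorus p (powMonoidHom (p ^ n) : A →* A).range ∧
      (powMonoidHom (p ^ n) : A →* A).range.FiniteIndex := by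
  let X : ℕ → Set A := fun n => {a | a ^ p = 1 ∧ ∃ b, b ^ p ^ n = a}
  have hX : ∀ n, (X n).Finite := fun n => hfin.subset fun a ha => ha.1
  have hanti : ∀ n m, X (n + m) ⊆ X n := by
    rintro n m a ⟨ha, b, rfl⟩
    exact ⟨ha, b ^ p ^ m, by rw [← pow_mul, ← pow_add, add_comm]⟩
  -- The `p`-torsion of the group of `p ^ n`-th powers decreases with `n` and is finite, so it
  -- stabilizes.
  obtain ⟨n, hn⟩ : ∃ n, ∀ m, (X n).ncard ≤ (X m).ncard := by
    obtain ⟨n, -, hn⟩ := WellFounded.has_min (measure fun n => (X n).ncard).wf Set.univ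
      ⟨0, Set.mem_univ _⟩
    exact ⟨n, fun m => not_lt.mp (hn m (Set.mem_univ _))⟩
  have hXn : ∀ m, X (n + m) = X n := fun m =>
    Set.eq_of_subset_of_ncard_le (hanti n m) (hn _) (hX n)
  -- Induction on the order of `a`: the power `a ^ p ^ r` lies in the stable `X n`, so it equals `c
  -- ^ p ^ (n + 1 + r)` for some `c`, and `a / c ^ p ^ (n + 1)` is killed by `p ^ r`.
  have hdiv : ∀ r (a : A), a ^ p ^ r = 1 → (∃ b, b ^ p ^ n = a) → ∃ b, b ^ p ^ (n + 1) = a := by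
    intro r
    induction r with
    | zero => intro a ha _; exact ⟨1, by simpa using ha.symm⟩
    | succ r ih =>
      rintro _ ha ⟨b, rfl⟩
      have h1 : (b ^ p ^ n) ^ p ^ r ∈ X n :=
        ⟨by rw [← pow_mul, ← pow_succ]; exact ha, b ^ p ^ r, by rw [← pow_mul, ← pow_mul, mul_comm]⟩
      rw [← hXn (r + 1)] at h1
      obtain ⟨-, c, hc⟩ := h1
      obtain ⟨d, hd⟩ := ih (b ^ p ^ n * (c ^ p ^ (n + 1))⁻¹) (by
        rw [mul_pow, ← hc, inv_pow, ← pow_mul c, ← pow_add]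
        rw [show n + 1 + r = n + (r + 1) by ring]; simp)
        ⟨b * (c ^ p)⁻¹, by rw [mul_pow, inv_pow, ← pow_mul c, pow_succ']⟩
      exact ⟨d * c, by rw [mul_pow, hd]; simp⟩
  have hdiv' : ∀ a : A, (∃ b, b ^ p ^ n = a) → ∃ b, b ^ p ^ (n + 1) = a := fun a ha => by
    obtain ⟨r, hr⟩ := htor a
    exact hdiv r a hr ha
  refine ⟨n, ⟨?_, ?_, ?_⟩, ?_⟩
  · rintro ⟨a, ha⟩
    obtain ⟨r, hr⟩ := htor a
    exact ⟨r, Subtype.ext hr⟩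
  · rintro ⟨a, ha⟩
    obtain ⟨b, hb⟩ := hdiv' a ha
    exact ⟨⟨b ^ p ^ n, b, rfl⟩, Subtype.ext (by
      change (b ^ p ^ n) ^ p = a
      rw [← pow_mul, ← pow_succ, hb])⟩
  · refine Set.Finite.of_finite_image (hfin.subset ?_) Subtype.val_injective.injOn
    rintro _ ⟨x, hx, rfl⟩
    exact congrArg Subtype.val hx
  · have hdiv2 : ∀ m (a : A), (∃ b, b ^ p ^ n = a) → ∃ b, b ^ p ^ (n + m) = a := by
      intro m
      induction m with
      | zero => exact fun a h => h
      | succ m ih =>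
        intro a ha
        obtain ⟨b, rfl⟩ := hdiv' a ha
        obtain ⟨c, hc⟩ := ih (b ^ p ^ n) ⟨b, rfl⟩
        exact ⟨c, by rw [← add_assoc, pow_succ, pow_mul, hc, ← pow_mul, ← pow_succ]⟩
    rw [Subgroup.finiteIndex_iff_finite_quotient]
    have hfin' := (finite_setOf_pow_pow_eq_one hfin n).to_subtype
    -- As `a ^ p ^ n = b ^ p ^ (n + n)`, the class of `a` is represented by `a / b ^ p ^ n`, which
    -- is `p ^ n`-torsion.
    refine Finite.of_surjective (fun a : {a : A | a ^ p ^ n = 1} =>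
      (QuotientGroup.mk (a : A) : A ⧸ (powMonoidHom (p ^ n) : A →* A).range)) fun y => ?_
    obtain ⟨a, rfl⟩ := QuotientGroup.mk_surjective y
    obtain ⟨b, hb⟩ := hdiv2 n (a ^ p ^ n) ⟨a, rfl⟩
    refine ⟨⟨a * (b ^ p ^ n)⁻¹, ?_⟩, ?_⟩
    · change (a * (b ^ p ^ n)⁻¹) ^ p ^ n = 1
      rw [mul_pow, inv_pow, ← pow_mul b, ← pow_add, hb, mul_inv_cancel]
    · exact QuotientGroup.eq.mpr ⟨b, by simp⟩

/-- An injective endomorphism permutes each of the finite sets of `p ^ n`-torsion elements. -/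
theorem IsPTorus.surjective_of_injective {p : ℕ} {A : Type*} [CommGroup A] (h : IsPTorus p A)
    (f : A →* A) (hf : Function.Injective f) : Function.Surjective f := by
  intro a
  obtain ⟨n, hn⟩ := h.torsion a
  have := (h.finite_pow n).to_subtype
  let g : {a : A | a ^ p ^ n = 1} → {a : A | a ^ p ^ n = 1} := fun x =>
    ⟨f x, by
      have hx : (x : A) ^ p ^ n = 1 := x.2
      change f x ^ p ^ n = 1
      rw [← map_pow, hx, map_one]⟩
  have hg : Function.Injective g := fun x y hxy => Subtype.ext (hf (congrArg Subtype.val hxy))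
  obtain ⟨b, hb⟩ := Finite.surjective_of_injective hg ⟨a, hn⟩
  exact ⟨b, congrArg Subtype.val hb⟩

/-! ### Orders of subgroups and centralizers -/

section Centralizers

variable {p : ℕ} {S : Type*} [Group S] {T : Subgroup S}

theorem isPGroup_of_isPTorus [T.Normal] [IsMulCommutative T] (hT : IsPTorus p T)
    (hST : IsPGroup p (S ⧸ T)) : IsPGroup p S := by
  intro g
  obtain ⟨i, hi⟩ := hST g
  have hg : g ^ p ^ i ∈ T := by
    rw [← QuotientGroup.eq_one_iff, QuotientGroup.mk_pow, hi]
  obtain ⟨j, hj⟩ := hT.torsion ⟨_, hg⟩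
  refine ⟨i + j, ?_⟩
  rw [pow_add, pow_mul]
  exact congrArg Subtype.val hj

/-- A subgroup `C` of a discrete `p`-toral group is discrete `p`-toral. The rank depends only on
the intersection of `C` with the identity component, and so does a bound on the number of
components. -/
theorem exists_hasPToralOrder [T.Normal] [IsMulCommutative T] [Finite (S ⧸ T)] (hp : p.Prime)
    (hT : IsPTorus p T) (hST : IsPGroup p (S ⧸ T)) (H : Subgroup S) (hH : H ≤ T) :
    ∃ k N : ℕ, ∀ C : Subgroup S, C ⊓ T = H → ∃ m ≤ N, HasPToralOrder p C k m := by
  have : IsMulCommutative H := ⟨⟨fun a b => Subtype.ext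
    (congrArg Subtype.val (mul_comm (⟨a, hH a.2⟩ : T) ⟨b, hH b.2⟩) :)⟩⟩
  obtain ⟨n, hn, hfin⟩ := exists_isPTorus_range_pow (p := p) (A := H)
    (fun a => by
      obtain ⟨r, hr⟩ := hT.torsion ⟨a, hH a.2⟩
      exact ⟨r, Subtype.ext (congrArg Subtype.val hr :)⟩)
    (by
      refine Set.Finite.of_finite_image ((hT.finite.image Subtype.val).subset ?_)
        Subtype.val_injective.injOn
      rintro _ ⟨x, hx, rfl⟩
      exact ⟨⟨x, hH x.2⟩, Subtype.ext (congrArg Subtype.val (show x ^ p = 1 from hx) :), rfl⟩)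
  let R : Subgroup H := (powMonoidHom (p ^ n) : H →* H).range
  let A : Subgroup S := R.map H.subtype
  obtain ⟨k, ⟨e⟩⟩ := hn.exists_mulEquiv hp
  have hAH : A ≤ H := Subgroup.map_subtype_le _
  -- The component of `C` is `A`, with `|C/A| = |H/R| |C/H|`, and `C/H` embeds in `S/T`.
  refine ⟨k, R.index * T.index, fun C hC => ?_⟩
  have hHC : H ≤ C := hC ▸ inf_le_left
  have hAC : A ≤ C := hAH.trans hHC
  have hrel : A.relIndex C = R.index * T.relIndex C := by
    rw [← Subgroup.relIndex_mul_relIndex A H C hAH hHC]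
    congr 1
    · rw [Subgroup.relIndex, Subgroup.subgroupOf, Subgroup.comap_map_eq_self_of_injective
        H.subtype_injective]
    · rw [← hC, Subgroup.inf_relIndex_left]
  have : T.FiniteIndex := Subgroup.finiteIndex_of_finite_quotient
  have hTC : T.relIndex C ≤ T.index := by
    rw [← Subgroup.relIndex_top_right T]
    exact Subgroup.relIndex_le_of_le_right le_top (by
      rw [Subgroup.relIndex_top_right]; exact Subgroup.FiniteIndex.index_ne_zero)
  have hTC0 : T.relIndex C ≠ 0 := fun h0 => Subgroup.FiniteIndex.index_ne_zero (H := T)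
    (Subgroup.index_eq_zero_of_relIndex_eq_zero h0)
  -- `A` consists of the `p ^ n`-th powers in `H = C ⊓ T`, which is normal in `C`.
  have hA : (A.subgroupOf C).Normal := by
    refine ⟨?_⟩
    rintro ⟨x, hx⟩ hxA ⟨c, hc⟩
    obtain ⟨_, ⟨h, rfl⟩, hh⟩ := hxA
    have hch : c * h * c⁻¹ ∈ H := by
      have : c * h * c⁻¹ ∈ C ⊓ T := ⟨C.mul_mem (C.mul_mem hc (hHC h.2)) (C.inv_mem hc),
        (inferInstance : T.Normal).conj_mem _ (hH h.2) c⟩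
      rwa [hC] at this
    refine ⟨_, ⟨⟨_, hch⟩, rfl⟩, ?_⟩
    change (c * h * c⁻¹) ^ p ^ n = c * x * c⁻¹
    rw [conj_pow]
    exact congrArg (fun y => c * y * c⁻¹) hh
  refine ⟨A.relIndex C, hrel ▸ Nat.mul_le_mul_left _ hTC, A.subgroupOf C, hA,
    ⟨((Subgroup.subgroupOfEquivOfLe hAC).trans
      (R.equivMapOfInjective H.subtype H.subtype_injective).symm).trans e⟩, ?_, ?_, rfl⟩
  · rw [← Subgroup.finiteIndex_iff_finite_quotient]
    refine ⟨?_⟩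
    change A.relIndex C ≠ 0
    rw [hrel]
    exact mul_ne_zero Subgroup.FiniteIndex.index_ne_zero hTC0
  · exact ((isPGroup_of_isPTorus hT hST).to_subgroup C).to_quotient _

/-- As `T` is abelian, the centralizer of `P` in `T` depends only on the image of `P` in the finite
group `S ⧸ T`. -/
theorem finite_range_centralizer_inf [T.Normal] [IsMulCommutative T] [Finite (S ⧸ T)] :
    (Set.range fun P : Subgroup S => Subgroup.centralizer (P : Set S) ⊓ T).Finite := by
  refine (Set.finite_range fun Q : Subgroup (S ⧸ T) =>
    Subgroup.centralizer (Q.comap (QuotientGroup.mk' T) : Set S) ⊓ T).subset ?_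
  rintro _ ⟨P, rfl⟩
  refine ⟨P.map (QuotientGroup.mk' T), ?_⟩
  simp only [Subgroup.comap_map_eq, QuotientGroup.ker_mk']
  ext t
  simp only [Subgroup.mem_inf]
  refine and_congr_left fun ht => ⟨fun h => ?_, fun h => ?_⟩
  · exact Subgroup.centralizer_le (SetLike.coe_subset_coe.mpr le_sup_left) h
  · have h1 : P ⊔ T ≤ Subgroup.centralizer {t} := by
      refine sup_le (fun x hx => ?_) (fun x hx => ?_)
      · rw [Subgroup.mem_centralizer_singleton_iff]
        exact Subgroup.mem_centralizer_iff.mp h x hx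
      · rw [Subgroup.mem_centralizer_singleton_iff]
        exact congrArg Subtype.val (mul_comm (⟨x, hx⟩ : T) ⟨t, ht⟩)
    rw [Subgroup.mem_centralizer_iff]
    intro x hx
    exact Subgroup.mem_centralizer_singleton_iff.mp (h1 hx)

end Centralizers

/-! ### Fully centralized subgroups and extension of morphisms -/

namespace FusionSystem

variable {p : ℕ} {S : Type*} [Group S] {T : Subgroup S} (F : FusionSystem S)

/-- A maximum exists because centralizers have only finitely many orders: the rank and a bound on
the number of components are determined by the intersection with `T`, for which there are finitely
many choices. -/
theorem exists_fullyCentralized [T.Normal] [IsMulCommutative T] [Finite (S ⧸ T)] (hp : p.Prime)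
    (hT : IsPTorus p T) (hST : IsPGroup p (S ⧸ T)) (P : Subgroup S) :
    ∃ Q : Subgroup S, F.IsConjugate P Q ∧ F.FullyCentralized p Q := by
  choose! k N hkN using fun H (hH : H ≤ T) => exists_hasPToralOrder hp hT hST H hH
  choose m hmN hm using fun Q : Subgroup S =>
    hkN (Subgroup.centralizer (Q : Set S) ⊓ T) inf_le_right _ rfl
  let X : Set (ℕ × ℕ) := (fun Q : Subgroup S =>
    (k (Subgroup.centralizer (Q : Set S) ⊓ T), m Q)) '' {Q | F.IsConjugate P Q}
  have hX : X.Finite := by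
    have h1 := (finite_range_centralizer_inf (T := T)).biUnion (t := fun H =>
      {k H} ×ˢ Set.Iic (N H)) fun H _ => (Set.finite_singleton _).prod (Set.finite_Iic _)
    refine h1.subset ?_
    rintro _ ⟨Q, -, rfl⟩
    exact Set.mem_biUnion (Set.mem_range_self Q) ⟨rfl, hmN Q⟩
  have hrefl : F.IsConjugate P P := ⟨1, (F.aut P).one_mem⟩
  obtain ⟨_, ⟨Q, hQ, rfl⟩, hmax⟩ := Set.exists_max_image X toLex hX ⟨_, P, hrefl, rfl⟩
  refine ⟨Q, hQ, fun Q' hQ' => ?_⟩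
  obtain ⟨e, he⟩ := hQ
  obtain ⟨e', he'⟩ := hQ'
  have := hmax _ ⟨Q', ⟨e.trans e', F.comp_mem he.1 he'.1, F.comp_mem he'.2 he.2⟩, rfl⟩
  exact ⟨_, _, _, _, hm Q', hm Q, Prod.Lex.toLex_le_toLex.mp this⟩

theorem subtype_comp_mem_homS {P Q : Subgroup S} {φ : P →* Q} (h : φ ∈ F.Hom P Q) :
    Q.subtype.comp φ ∈ F.HomS P := by
  have h2 : (Subgroup.topEquiv.symm.toMonoidHom : S →* (⊤ : Subgroup S)).comp Q.subtype ∈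
      F.Hom Q ⊤ := F.conj_mem _ ⟨1, fun x => by simp⟩
  exact F.comp_mem h h2

theorem subtype_mem_homS (P : Subgroup S) : P.subtype ∈ F.HomS P :=
  F.conj_mem _ ⟨1, fun x => by simp⟩

theorem injective_of_mem_homS {P : Subgroup S} {φ : P →* S} (h : φ ∈ F.HomS P) :
    Function.Injective φ := fun x y hxy => F.injective h (by simp [hxy])

theorem exists_iso_of_mem_homS {P : Subgroup S} {φ : P →* S} (h : φ ∈ F.HomS P) :
    ∃ e ∈ F.Iso P φ.range, ∀ x, (e x : S) = φ x := by
  obtain ⟨R, hR, e, he, he', hφ⟩ := F.factor h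
  have h1 : ∀ x, φ x = e x := fun x => congrArg Subtype.val (DFunLike.congr_fun hφ x)
  have h2 : φ.range = R := by
    ext y
    constructor
    · rintro ⟨x, rfl⟩
      rw [h1]
      exact (e x).2
    · intro hy
      exact ⟨e.symm ⟨y, hy⟩, by rw [h1, e.apply_symm_apply]⟩
  subst h2
  exact ⟨e, ⟨he, he'⟩, fun x => (h1 x).symm⟩

theorem codRestrict_mem_hom {P Q : Subgroup S} {φ : P →* S} (h : φ ∈ F.HomS P)
    (hQ : ∀ x, φ x ∈ Q) : φ.codRestrict Q hQ ∈ F.Hom P Q := by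
  obtain ⟨e, he, hφ⟩ := F.exists_iso_of_mem_homS h
  have hle : φ.range ≤ Q := by rintro _ ⟨x, rfl⟩; exact hQ x
  have h1 : Subgroup.inclusion hle ∈ F.Hom φ.range Q := F.conj_mem _ ⟨1, fun x => by simp⟩
  have := F.comp_mem he.1 h1
  convert! this using 1
  ext x
  exact (hφ x).symm

theorem comp_mem_homS {P Q : Subgroup S} {φ : P →* S} {ψ : Q →* S} (h : φ ∈ F.HomS P)
    (h' : ψ ∈ F.HomS Q) (hQ : ∀ x, φ x ∈ Q) : ψ.comp (φ.codRestrict Q hQ) ∈ F.HomS P :=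
  F.comp_mem (F.codRestrict_mem_hom h hQ) h'

theorem restrict_mem_homS {P Q : Subgroup S} {φ : P →* S} (h : φ ∈ F.HomS P) (hQ : Q ≤ P) :
    φ.comp (Subgroup.inclusion hQ) ∈ F.HomS Q :=
  F.comp_mem_homS (F.subtype_mem_homS Q) h fun x => hQ x.2

theorem exists_inverse_mem_homS {P : Subgroup S} {φ : P →* S} (h : φ ∈ F.HomS P) :
    ∃ ψ ∈ F.HomS φ.range, ∀ x, ψ ⟨φ x, x, rfl⟩ = x := by
  obtain ⟨e, he, hφ⟩ := F.exists_iso_of_mem_homS h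
  refine ⟨_, F.subtype_comp_mem_homS he.2, fun x => ?_⟩
  have : (⟨φ x, x, rfl⟩ : φ.range) = e x := Subtype.ext (hφ x).symm
  rw [this]
  simp

theorem centralizer_le_extender {P : Subgroup S} (φ : P →* S) :
    Subgroup.centralizer (P : Set S) ≤ extender φ := by
  intro g hg
  have hc : ∀ x ∈ P, g * x * g⁻¹ = x := fun x hx => by
    rw [← Subgroup.mem_centralizer_iff.mp hg x hx, mul_inv_cancel_right]
  refine ⟨Subgroup.centralizer_le_normalizer _ hg, 1, fun x y hxy => ?_⟩
  rw [hc x x.2] at hxy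
  rw [Subtype.ext hxy]
  simp

/-- Every `P` has a morphism `e` to `S` such that, for every morphism `f` from `P` to `S`, the
morphism `e ∘ f⁻¹` on `f(P)` extends to the centralizer of `f(P)`. -/
theorem exists_extension_to_centralizer [T.Normal] [IsMulCommutative T] [Finite (S ⧸ T)]
    (hp : p.Prime) (hT : IsPTorus p T) (hST : IsPGroup p (S ⧸ T)) (hF : F.IsSaturated p)
    (P : Subgroup S) :
    ∃ e ∈ F.HomS P, ∀ f ∈ F.HomS P, ∃ Q : Subgroup S, f.range ≤ Q ∧
      Subgroup.centralizer (f.range : Set S) ≤ Q ∧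
        ∃ ψ ∈ F.HomS Q, ∀ x (h : f x ∈ Q), ψ ⟨f x, h⟩ = e x := by
  -- With `e(P)` fully centralized, axiom (II) extends `e ∘ f⁻¹` to its extender, which contains the
  -- centralizer of `f(P)`.
  obtain ⟨P₁, ⟨e, he⟩, hP₁⟩ := F.exists_fullyCentralized hp hT hST P
  refine ⟨_, F.subtype_comp_mem_homS he.1, fun f hf => ?_⟩
  obtain ⟨i, hi, hfi⟩ := F.exists_iso_of_mem_homS hf
  let φ : f.range →* S := P₁.subtype.comp (i.symm.trans e).toMonoidHom
  have hφ : φ ∈ F.HomS f.range := F.subtype_comp_mem_homS (F.comp_mem hi.2 he.1)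
  have hr : φ.range = P₁ := by
    rw [MonoidHom.range_comp, MonoidHom.range_eq_top.mpr (i.symm.trans e).surjective,
      ← MonoidHom.range_eq_map, Subgroup.range_subtype]
  obtain ⟨ψ, hψ, hψφ⟩ := hF.extension f.range φ hφ (by rw [hr]; exact hP₁)
  refine ⟨extender φ, le_extender φ, centralizer_le_extender φ, ψ, hψ, fun x h => ?_⟩
  have h1 := DFunLike.congr_fun hψφ (⟨f x, x, rfl⟩ : f.range)
  have h2 : (⟨f x, x, rfl⟩ : f.range) = i x := Subtype.ext (hfi x).symm
  have h3 : φ ⟨f x, x, rfl⟩ = e x := by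
    rw [h2]
    simp [φ]
  rw [h3] at h1
  exact h1

end FusionSystem

/-! ### Norms and fusion in the identity component -/

section NormEnd

variable {A : Type*} [CommGroup A]

/-- The endomorphism `a ↦ ∏_{i < q} αⁱ(a)`. -/
def normEnd (q : ℕ) (α : MulAut A) : A →* A := ∏ i ∈ Finset.range q, (α ^ i : MulAut A).toMonoidHom

theorem normEnd_apply (q : ℕ) (α : MulAut A) (a : A) :
    normEnd q α a = ∏ i ∈ Finset.range q, (α ^ i) a := by
  simp [normEnd, MonoidHom.finsetProd_apply]

theorem normEnd_apply_of_fixed (q : ℕ) {α : MulAut A} {a : A} (h : α a = a) :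
    normEnd q α a = a ^ q := by
  rw [normEnd_apply, Finset.prod_congr rfl (g := fun _ => a), Finset.prod_const, Finset.card_range]
  intro i hi
  clear hi
  induction i with
  | zero => rfl
  | succ i ih => rw [pow_succ, MulAut.mul_apply, h]; exact ih

/-- Applying `α` shifts the factors cyclically. -/
theorem map_normEnd (q : ℕ) {α : MulAut A} (h : α ^ q = 1) (a : A) :
    α (normEnd q α a) = normEnd q α a := by
  have h1 : α (normEnd q α a) = ∏ i ∈ Finset.range q, (α ^ (i + 1)) a := by
    rw [normEnd_apply, map_prod]
    exact Finset.prod_congr rfl fun i _ => by rw [pow_succ', MulAut.mul_apply]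
  have h2 := Finset.prod_range_succ' (fun i => (α ^ i) a) q
  rw [Finset.prod_range_succ, h] at h2
  rw [h1, normEnd_apply]
  simpa using h2.symm

end NormEnd

section Torus

variable {p : ℕ} {S : Type*} [Group S] {T : Subgroup S}

/-- Homomorphisms from divisible groups to `S` take values in the identity component. -/
theorem mem_of_divisible [T.Normal] {q : ℕ} (hq : ∀ x : S, x ^ q ∈ T) {D : Type*} [Group D]
    (hD : ∀ d : D, ∃ d', d' ^ q = d) (ψ : D →* S) (d : D) : ψ d ∈ T := by
  obtain ⟨d', rfl⟩ := hD d
  rw [map_pow]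
  exact hq _

end Torus

namespace FusionSystem

variable {p : ℕ} {S : Type*} [Group S] {T : Subgroup S} (F : FusionSystem S)

theorem conjNormal_mem_aut [T.Normal] (x : S) : (MulAut.conjNormal x : MulAut T) ∈ F.aut T :=
  ⟨F.conj_mem _ ⟨x, fun t => by simp⟩, F.conj_mem _ ⟨x⁻¹, fun t => by
    change ((MulAut.conjNormal x : MulAut T)⁻¹ t : S) = _
    rw [← map_inv]
    simp⟩⟩

/-- The identity component of a discrete `p`-toral group `S`, together with an exponent of the
quotient. -/
structure IsIdentityComponent (p q : ℕ) (T : Subgroup S) [T.Normal] [IsMulCommutative T] :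
    Prop where
  isPTorus : IsPTorus p T
  isPGroup : IsPGroup p (S ⧸ T)
  finite : Finite (S ⧸ T)
  pow_mem : ∀ x : S, x ^ q ∈ T
  exists_root : ∀ t : T, ∃ t', t' ^ q = t

variable {F} {q : ℕ} [T.Normal] [IsMulCommutative T]

/-- Divisibility keeps the image inside `T`, and an injective endomorphism of a `p`-torus is onto.
-/
theorem exists_mulAut_of_mem_homS (h : IsIdentityComponent p q T) {ψ : T →* S}
    (hψ : ψ ∈ F.HomS T) : ∃ w ∈ F.aut T, ∀ t, (w t : S) = ψ t := by
  have hmem : ∀ t, ψ t ∈ T := mem_of_divisible h.pow_mem h.exists_root ψ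
  have hr : ψ.range = T := by
    have hsurj := h.isPTorus.surjective_of_injective (ψ.codRestrict T hmem) fun x y hxy =>
      F.injective_of_mem_homS hψ (congrArg Subtype.val hxy)
    ext y
    constructor
    · rintro ⟨t, rfl⟩; exact hmem t
    · intro hy
      obtain ⟨t, ht⟩ := hsurj ⟨y, hy⟩
      exact ⟨t, congrArg Subtype.val ht⟩
  obtain ⟨e, he, heψ⟩ := F.exists_iso_of_mem_homS hψ
  obtain ⟨w, hw, hwψ⟩ : ∃ w ∈ F.Iso T T, ∀ t, (w t : S) = ψ t := by
    generalize ψ.range = R at hr e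
    subst hr
    exact ⟨e, he, heψ⟩
  exact ⟨w, hw, hwψ⟩

/-- The only conjugate of `T` is `T` itself, so all that is needed is that its normalizer has an
order. -/
theorem fullyNormalized_of_isIdentityComponent (hp : p.Prime) (h : IsIdentityComponent p q T) :
    F.FullyNormalized p T := by
  rintro T' ⟨e, he⟩
  have := h.finite
  have hψ := F.subtype_comp_mem_homS he.1
  obtain ⟨w, -, hw⟩ := exists_mulAut_of_mem_homS h hψ
  have hT' : T' = T := by
    ext y
    constructor
    · intro hy
      have h1 := hw (e.symm ⟨y, hy⟩)
      have h2 : (w (e.symm ⟨y, hy⟩) : S) = y := by rw [h1]; simp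
      exact h2 ▸ (w (e.symm ⟨y, hy⟩)).2
    · intro hy
      have h1 := hw (w.symm ⟨y, hy⟩)
      have h2 : (e (w.symm ⟨y, hy⟩) : S) = y := by
        rw [MulEquiv.apply_symm_apply] at h1; exact h1.symm
      exact h2 ▸ (e (w.symm ⟨y, hy⟩)).2
  subst hT'
  obtain ⟨k, N, hkN⟩ := exists_hasPToralOrder hp h.isPTorus h.isPGroup _ inf_le_right
  obtain ⟨m, -, hm⟩ := hkN (Subgroup.normalizer (T' : Set S)) rfl
  exact ⟨k, m, k, m, hm, hm, Or.inr ⟨rfl, le_rfl⟩⟩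

/-- `Inn(T)` is trivial, so `Aut_F(T)` is `Out_F(T)`, finite by axiom (I). -/
theorem finite_aut (hp : p.Prime) (hF : F.IsSaturated p) (h : IsIdentityComponent p q T) :
    Finite (F.aut T) := by
  have := (hF.sylow T (fullyNormalized_of_isIdentityComponent hp h)).2.1
  refine Finite.of_injective (QuotientGroup.mk : F.aut T → F.Out T) fun a b hab => ?_
  obtain ⟨t, ht⟩ := QuotientGroup.eq.mp hab
  have h1 : MulAut.conj t = 1 := by
    ext x
    simp [mul_comm t x]
  rw [h1] at ht
  have : (1 : F.aut T) = a⁻¹ * b := Subtype.ext ht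
  exact inv_mul_eq_one.mp this.symm

/-- Fusion in the identity component is controlled by its automorphism group. -/
theorem exists_mulAut_eq (hp : p.Prime) (hF : F.IsSaturated p) (h : IsIdentityComponent p q T)
    {P : Subgroup S} (hP : P ≤ T) {f : P →* S} (hf : f ∈ F.HomS P) (hfT : ∀ x, f x ∈ T) :
    ∃ w ∈ F.aut T, ∀ x : P, (w ⟨x, hP x.2⟩ : S) = f x := by
  have := h.finite
  obtain ⟨e, he, hext⟩ := F.exists_extension_to_centralizer hp h.isPTorus h.isPGroup hF P
  -- `T` is abelian, so it centralizes `f(P)` and the extension of `e ∘ f⁻¹` restricts to an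
  -- automorphism of `T`. Comparing the cases of the inclusion and of the given `f` yields `w`.
  have key : ∀ f ∈ F.HomS P, ∀ hfT : ∀ x, f x ∈ T,
      ∃ w ∈ F.aut T, ∀ x, (w ⟨f x, hfT x⟩ : S) = e x := by
    intro f hf hfT
    obtain ⟨Q, -, hQ, ψ, hψ, hψe⟩ := hext f hf
    have hTQ : T ≤ Q := by
      refine le_trans (fun t ht => ?_) hQ
      rw [Subgroup.mem_centralizer_iff]
      rintro _ ⟨x, rfl⟩
      exact congrArg Subtype.val (mul_comm (⟨f x, hfT x⟩ : T) ⟨t, ht⟩)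
    obtain ⟨w, hw, hwψ⟩ := exists_mulAut_of_mem_homS h (F.restrict_mem_homS hψ hTQ)
    exact ⟨w, hw, fun x => (hwψ _).trans (hψe x (hTQ (hfT x)))⟩
  obtain ⟨w₁, hw₁, h₁⟩ := key P.subtype (F.subtype_mem_homS P) fun x => hP x.2
  obtain ⟨w₂, hw₂, h₂⟩ := key f hf hfT
  refine ⟨w₂⁻¹ * w₁, (F.aut T).mul_mem ((F.aut T).inv_mem hw₂) hw₁, fun x => ?_⟩
  have h3 : w₁ ⟨x, hP x.2⟩ = w₂ ⟨f x, hfT x⟩ := Subtype.ext ((h₁ x).trans (h₂ x).symm)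
  rw [MulAut.mul_apply, h3, MulAut.inv_apply_self]

/-- If an element `z` of the identity component is conjugate to an element outside of it, then
one of finitely many divisible subgroups does not contain `z`, but does contain its power
`z ^ (q * q)`. -/
theorem exists_notMem_range_of_conj (hp : p.Prime) (hF : F.IsSaturated p)
    (h : IsIdentityComponent p q T) {x : S} (hx : x ∉ T) {f : Subgroup.zpowers x →* S}
    (hf : f ∈ F.HomS (Subgroup.zpowers x)) {z : T}
    (hz : f ⟨x, Subgroup.mem_zpowers x⟩ = z) :
    ∃ w ∈ F.aut T, ∃ α ∈ F.aut T, z ∉ (w.toMonoidHom.comp (normEnd q α)).range ∧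
      z ^ (q * q) ∈ (w.toMonoidHom.comp (normEnd q α)).range := by
  have := h.finite
  let α : MulAut T := MulAut.conjNormal x
  have hα : α ^ q = 1 := by
    ext t
    rw [← map_pow, MulAut.conjNormal_apply, MulAut.one_apply]
    have := congrArg Subtype.val (mul_comm (⟨x ^ q, h.pow_mem x⟩ : T) t)
    change x ^ q * (t : S) = t * x ^ q at this
    rw [this, mul_inv_cancel_right]
  let D : Subgroup S := (normEnd q α).range.map T.subtype
  have hDT : D ≤ T := Subgroup.map_subtype_le _
  have hDC : D ≤ Subgroup.centralizer (Subgroup.zpowers x : Set S) := by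
    rintro _ ⟨_, ⟨t, rfl⟩, rfl⟩
    have h1 : x * (normEnd q α t : S) * x⁻¹ = normEnd q α t :=
      congrArg Subtype.val (map_normEnd q hα t)
    have h2 : Subgroup.zpowers x ≤ Subgroup.centralizer {(normEnd q α t : S)} := by
      rw [Subgroup.zpowers_le, Subgroup.mem_centralizer_singleton_iff]
      exact mul_inv_eq_iff_eq_mul.mp h1
    rw [Subgroup.mem_centralizer_iff]
    intro y hy
    exact Subgroup.mem_centralizer_singleton_iff.mp (h2 hy)
  have hDdiv : ∀ d : D, ∃ d', d' ^ q = d := by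
    rintro ⟨_, _, ⟨t, rfl⟩, rfl⟩
    obtain ⟨t', rfl⟩ := h.exists_root t
    exact ⟨⟨normEnd q α t', _, ⟨t', rfl⟩, rfl⟩, Subtype.ext (by simp)⟩
  -- `x ^ q` lies in `T` and is fixed by `α`, so its norm is its `q`-th power.
  have hxD : x ^ (q * q) ∈ D := by
    have hfix : α ⟨x ^ q, h.pow_mem x⟩ = ⟨x ^ q, h.pow_mem x⟩ := Subtype.ext (by
      change x * x ^ q * x⁻¹ = x ^ q
      rw [← pow_succ', pow_succ, mul_inv_cancel_right])
    refine ⟨_, ⟨⟨x ^ q, h.pow_mem x⟩, rfl⟩, ?_⟩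
    rw [normEnd_apply_of_fixed q hfix]
    simp [pow_mul]
  have hfT : f.range ≤ T := by
    rintro _ ⟨⟨y, n, rfl⟩, rfl⟩
    have : (⟨x ^ n, n, rfl⟩ : Subgroup.zpowers x) = ⟨x, Subgroup.mem_zpowers x⟩ ^ n :=
      Subtype.ext (by simp)
    change f ⟨x ^ n, n, rfl⟩ ∈ T
    rw [this, map_zpow, hz]
    exact T.zpow_mem z.2 n
  obtain ⟨e, he, hext⟩ := F.exists_extension_to_centralizer hp h.isPTorus h.isPGroup hF
    (Subgroup.zpowers x)
  obtain ⟨w₁, hw₁, h₁⟩ : ∃ w ∈ F.aut T, (w z : S) = e ⟨x, Subgroup.mem_zpowers x⟩ := by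
    obtain ⟨Q, -, hQ, ψ, hψ, hψe⟩ := hext f hf
    have hTQ : T ≤ Q := by
      refine le_trans (fun t ht => ?_) hQ
      rw [Subgroup.mem_centralizer_iff]
      intro y hy
      exact congrArg Subtype.val (mul_comm (⟨y, hfT hy⟩ : T) ⟨t, ht⟩)
    obtain ⟨w, hw, hwψ⟩ := exists_mulAut_of_mem_homS h (F.restrict_mem_homS hψ hTQ)
    refine ⟨w, hw, (hwψ z).trans ?_⟩
    rw [← hψe ⟨x, Subgroup.mem_zpowers x⟩ (by rw [hz]; exact hTQ z.2)]
    exact congrArg ψ (Subtype.ext hz.symm)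
  -- This `ψ` is defined both at `x` and on `D`, which centralizes `x`. It sends `x` to `w₁ z` and,
  -- `D` being divisible, agrees on `D` with some `w₂`.
  obtain ⟨Q, hxQ, hQ, ψ, hψ, hψe⟩ := hext _ (F.subtype_mem_homS _)
  rw [Subgroup.range_subtype] at hxQ hQ
  have hxQ' : x ∈ Q := hxQ (Subgroup.mem_zpowers x)
  have hψx : ψ ⟨x, hxQ'⟩ = w₁ z :=
    (hψe ⟨x, Subgroup.mem_zpowers x⟩ hxQ').trans h₁.symm
  have hDQ : D ≤ Q := hDC.trans hQ
  obtain ⟨w₂, hw₂, h₂⟩ := exists_mulAut_eq hp hF h hDT (F.restrict_mem_homS hψ hDQ)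
    (mem_of_divisible h.pow_mem hDdiv _)
  refine ⟨w₁⁻¹ * w₂, (F.aut T).mul_mem ((F.aut T).inv_mem hw₁) hw₂, α, F.conjNormal_mem_aut x,
    ?_, ?_⟩
  -- Otherwise `ψ` would take the same value at `x` and at an element of `D ≤ T`.
  · rintro ⟨t, ht⟩
    have h3 : w₂ (normEnd q α t) = w₁ z := by
      rw [← ht]
      change _ = w₁ (w₁⁻¹ (w₂ (normEnd q α t)))
      rw [MulAut.apply_inv_self]
    have h4 := h₂ ⟨normEnd q α t, _, ⟨t, rfl⟩, rfl⟩
    have h5 : ψ ⟨x, hxQ'⟩ = ψ ⟨normEnd q α t, hDQ ⟨_, ⟨t, rfl⟩, rfl⟩⟩ := by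
      rw [hψx, ← h3]
      exact h4
    have h6 : x = normEnd q α t := congrArg Subtype.val (F.injective_of_mem_homS hψ h5)
    exact hx (h6 ▸ (normEnd q α t).2)
  · obtain ⟨_, ⟨t, rfl⟩, ht⟩ := id hxD
    refine ⟨t, ?_⟩
    have h4 := h₂ ⟨x ^ (q * q), hxD⟩
    have h5 : (w₂ (normEnd q α t)) = w₁ z ^ (q * q) := by
      apply Subtype.ext
      have h6 : normEnd q α t = ⟨x ^ (q * q), hDT hxD⟩ := Subtype.ext ht
      rw [h6, h4, T.coe_pow, ← hψx, ← map_pow]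
      rfl
    change w₁⁻¹ (w₂ (normEnd q α t)) = _
    rw [h5, map_pow, MulAut.inv_apply_self]

end FusionSystem

/-! ### Characters of the identity component -/

section Characters

variable {A : Type*} [CommGroup A]

/-- The inclusion of `ℚ/ℤ` into `ℝ/ℤ`. -/
noncomputable def ratCircleToUnitAddCircle : AddCircle (1 : ℚ) →+ UnitAddCircle :=
  QuotientAddGroup.map _ _ (Rat.castHom ℝ).toAddMonoidHom (by
    rw [AddSubgroup.zmultiples_le]
    exact ⟨1, by simp⟩)

theorem ratCircleToUnitAddCircle_injective : Function.Injective ratCircleToUnitAddCircle := by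
  rw [injective_iff_map_eq_zero]
  intro x hx
  obtain ⟨x, rfl⟩ := QuotientAddGroup.mk_surjective x
  obtain ⟨n, hn⟩ := (AddCircle.coe_eq_zero_iff (1 : ℝ)).mp (show ((x : ℝ) : UnitAddCircle) = 0
    from hx)
  refine (AddCircle.coe_eq_zero_iff (1 : ℚ)).mpr ⟨n, ?_⟩
  have : ((n : ℚ) : ℝ) = x := by simpa using hn
  simpa using Rat.cast_injective this

/-- The characters of `A / D` separate the elements of `A / D` from `1`. -/
theorem exists_character_ne_one (D : Subgroup A) {y : A} (hy : y ∉ D) :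
    ∃ χ : A →* Circle, (∀ d ∈ D, χ d = 1) ∧ χ y ≠ 1 := by
  have h0 : Additive.ofMul (y : A ⧸ D) ≠ 0 := fun h => hy ((QuotientGroup.eq_one_iff y).mp h)
  obtain ⟨c, hc⟩ := CharacterModule.exists_character_apply_ne_zero_of_ne_zero h0
  let χ : A →* Circle := MonoidHom.mk'
    (fun a => AddCircle.toCircle (ratCircleToUnitAddCircle (c (Additive.ofMul (a : A ⧸ D)))))
    fun a b => by
      rw [QuotientGroup.mk_mul, ofMul_mul, map_add, map_add, AddCircle.toCircle_add]
  refine ⟨χ, fun d hd => ?_, fun h => hc ?_⟩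
  · change AddCircle.toCircle (ratCircleToUnitAddCircle (c (Additive.ofMul (d : A ⧸ D)))) = 1
    rw [(QuotientGroup.eq_one_iff d).mpr hd, ofMul_one, map_zero, map_zero, AddCircle.toCircle_zero]
  · apply ratCircleToUnitAddCircle_injective
    apply AddCircle.injective_toCircle one_ne_zero
    rw [map_zero, AddCircle.toCircle_zero]
    exact h

/-- Finitely many characters suffice to separate from `1` the elements of order dividing `Q` of
finitely many quotients by divisible subgroups. -/
theorem exists_finite_family_characters {Q : ℕ} (hfin : {a : A | a ^ Q = 1}.Finite) {ι : Type*}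
    [Finite ι] (D : ι → Subgroup A) (hD : ∀ i, ∀ d ∈ D i, ∃ d' ∈ D i, d' ^ Q = d) :
    ∃ (L : Set (A →* Circle)), L.Finite ∧ ∀ i z, z ∉ D i → z ^ Q ∈ D i →
      ∃ χ ∈ L, χ z ≠ 1 ∧ χ z ^ Q = 1 := by
  have := hfin.to_subtype
  choose! χ h₁ h₂ using fun (x : ι × A) (hx : x.2 ∉ D x.1) => exists_character_ne_one (D x.1) hx
  refine ⟨Set.range fun x : ι × {a : A | a ^ Q = 1} => χ (x.1, x.2), Set.finite_range _,
    fun i z hz hzQ => ?_⟩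
  -- Modulo the divisible `D i`, `z` is represented by a `Q`-torsion element; characters trivial on
  -- `D i` do not see the difference.
  obtain ⟨d, hd, hdQ⟩ := hD i _ hzQ
  have hy : (z * d⁻¹) ^ Q = 1 := by rw [mul_pow, inv_pow, hdQ, mul_inv_cancel]
  have hyD : z * d⁻¹ ∉ D i := fun h => hz (by simpa using mul_mem h hd)
  refine ⟨_, ⟨(i, ⟨_, hy⟩), rfl⟩, ?_, ?_⟩
  · have := h₂ (i, z * d⁻¹) hyD
    rwa [map_mul, map_inv, h₁ (i, z * d⁻¹) hyD d hd, inv_one, mul_one] at this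
  · rw [← map_pow]
    exact h₁ (i, z * d⁻¹) hyD _ hzQ

/-- A nontrivial element has a power of order `p`, and `L` detects that power. -/
theorem eq_one_of_forall_character_eq_one {p Q : ℕ} (htor : ∀ a : A, ∃ n : ℕ, a ^ p ^ n = 1)
    (hpQ : p ∣ Q) {L : Set (A →* Circle)} (hL : ∀ a : A, a ≠ 1 → a ^ Q = 1 → ∃ χ ∈ L, χ a ≠ 1)
    {a : A} (ha : ∀ χ ∈ L, χ a = 1) : a = 1 := by
  obtain ⟨n, hn⟩ := htor a
  induction n generalizing a with
  | zero => simpa using hn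
  | succ n ih =>
    have h1 : a ^ p = 1 := ih (fun χ hχ => by rw [map_pow, ha χ hχ, one_pow])
      (by rw [← pow_mul, ← pow_succ', hn])
    by_contra h
    obtain ⟨Q', rfl⟩ := hpQ
    obtain ⟨χ, hχ, hne⟩ := hL a h (by rw [pow_mul, h1, one_pow])
    exact hne (ha χ hχ)

/-- For a finite group `W` of automorphisms of `A` and a finite set `L` of characters,
the tensor product, over the `W`-translates `χ` of the elements of `L`, of the representations
`1 ⊕ χ ⊕ ⋯ ⊕ χ^(Q-1)`. It is `W`-invariant, and vanishes where some `χ ∈ L` takes as its value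
a nontrivial `Q`-th root of unity. -/
theorem exists_invariant_characters.{u} {A : Type u} [CommGroup A] (W : Subgroup (MulAut A)) [Finite W] {L : Set (A →* Circle)}
    (hL : L.Finite) {Q : ℕ} (hQ : 2 ≤ Q) :
    ∃ (I : Type u) (_ : Fintype I) (_ : Nonempty I) (θ : I → A →* Circle),
      (∀ w ∈ W, ∀ a, ∑ i, (θ i (w a) : ℂ) = ∑ i, (θ i a : ℂ)) ∧
      (∀ χ ∈ L, ∀ a, χ a ≠ 1 → χ a ^ Q = 1 → ∑ i, (θ i a : ℂ) = 0) ∧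
      ∀ a, (∀ i, θ i a = 1) → ∀ χ ∈ L, χ a = 1 := by
  classical
  cases nonempty_fintype W
  have := hL.fintype
  have : NeZero Q := ⟨by omega⟩
  let θ : (W × L → Fin Q) → A →* Circle := fun g =>
    ∏ x : W × L, ((x.2 : A →* Circle).comp (x.1 : MulAut A).toMonoidHom) ^ (g x : ℕ)
  have hθ : ∀ g a, θ g a = ∏ x : W × L, (x.2 : A →* Circle) ((x.1 : MulAut A) a) ^ (g x : ℕ) :=
    fun g a => by simp [θ, MonoidHom.finsetProd_apply]
  have hsum : ∀ a, ∑ g, (θ g a : ℂ) = ∏ x : W × L, ∑ n ∈ Finset.range Q,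
      ((x.2 : A →* Circle) ((x.1 : MulAut A) a) : ℂ) ^ n := fun a => by
    simp_rw [← Fin.sum_univ_eq_sum_range, Fintype.prod_sum]
    refine Finset.sum_congr rfl fun g _ => ?_
    rw [hθ]
    exact (map_prod Circle.coeHom _ _).trans (Finset.prod_congr rfl fun x _ => Circle.coe_pow _ _)
  refine ⟨W × L → Fin Q, inferInstance, inferInstance, θ, fun w hw a => ?_, fun χ hχ a h1 hQ1 => ?_,
    fun a ha χ hχ => ?_⟩
  · rw [hsum, hsum]
    -- Precomposing with `w` permutes the translates by right multiplication in `W`.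
    refine Fintype.prod_equiv ((Equiv.mulRight (⟨w, hw⟩ : W)).prodCongr (Equiv.refl L)) _ _ ?_
    intro x
    rfl
  · rw [hsum]
    refine Finset.prod_eq_zero (Finset.mem_univ ((1 : W), (⟨χ, hχ⟩ : L))) ?_
    change ∑ n ∈ Finset.range Q, (χ a : ℂ) ^ n = 0
    rw [geom_sum_eq (fun h => h1 (Circle.coe_eq_one.mp h)), ← Circle.coe_pow, hQ1]
    simp
  -- Exponent `1` at `(1, χ)`, available as `Q ≥ 2`, and `0` elsewhere makes `χ` itself one of the
  -- `θ i`.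
  · have := ha (Pi.single (M := fun _ : W × L => Fin Q) ((1 : W), (⟨χ, hχ⟩ : L))
      (⟨1, by omega⟩ : Fin Q))
    rw [hθ, Finset.prod_eq_single ((1 : W), (⟨χ, hχ⟩ : L))] at this
    · simpa using this
    · intro x _ hx
      rw [Pi.single_eq_of_ne hx]
      simp
    · simp

end Characters

/-! ### The induced representation -/

section Induced

variable {S : Type*} [Group S] {T : Subgroup S} {I K : Type*}

/-- The cocycle describing the action of `S` on the cosets of `T` by a set of representatives. -/
noncomputable def cosetCocycle (T : Subgroup S) (s : S) (x : S ⧸ T) : T :=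
  ⟨x.out⁻¹ * (s * (s⁻¹ • x).out), by
    rw [← QuotientGroup.eq, QuotientGroup.out_eq', ← smul_eq_mul, ← MulAction.Quotient.smul_mk,
      QuotientGroup.out_eq', smul_inv_smul]⟩

theorem cosetCocycle_mul (s t : S) (x : S ⧸ T) :
    cosetCocycle T (s * t) x = cosetCocycle T s x * cosetCocycle T t (s⁻¹ • x) := by
  apply Subtype.ext
  simp only [cosetCocycle, Subgroup.coe_mul, mul_inv_rev, mul_smul]
  group

theorem cosetCocycle_one (x : S ⧸ T) : cosetCocycle T 1 x = 1 := by
  apply Subtype.ext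
  simp [cosetCocycle]

/-- The representation of `S` induced from the direct sum of characters `θ i` of `T`, in a basis
indexed by `K ≃ (S ⧸ T) × I`. -/
noncomputable def inducedRep (θ : I → T →* Circle) (e : K ≃ (S ⧸ T) × I) :
    Representation ℂ S (EuclideanSpace ℂ K) where
  toFun s :=
    { toFun := fun v => WithLp.toLp 2 fun k =>
        (θ (e k).2 (cosetCocycle T s (e k).1) : ℂ) * v (e.symm (s⁻¹ • (e k).1, (e k).2))
      map_add' := fun v w => by ext k; simp [mul_add]
      map_smul' := fun c v => by ext k; simp [mul_left_comm] }
  map_one' := by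
    ext v k
    simp [cosetCocycle_one]
  map_mul' s t := by
    ext v k
    simp [cosetCocycle_mul, mul_smul, mul_assoc]

theorem inducedRep_apply (θ : I → T →* Circle) (e : K ≃ (S ⧸ T) × I) (s : S)
    (v : EuclideanSpace ℂ K) (k : K) :
    inducedRep θ e s v k =
      (θ (e k).2 (cosetCocycle T s (e k).1) : ℂ) * v (e.symm (s⁻¹ • (e k).1, (e k).2)) := rfl

theorem inner_inducedRep [Fintype K] (θ : I → T →* Circle) (e : K ≃ (S ⧸ T) × I) (s : S)
    (v w : EuclideanSpace ℂ K) :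
    inner ℂ (inducedRep θ e s v) (inducedRep θ e s w) = inner ℂ v w := by
  rw [PiLp.inner_apply, PiLp.inner_apply]
  let π : K ≃ K := (e.trans ((MulAction.toPerm s⁻¹).prodCongr (Equiv.refl I))).trans e.symm
  refine Fintype.sum_equiv π _ _ fun k => ?_
  rw [inducedRep_apply, inducedRep_apply]
  simp only [RCLike.inner_apply, map_mul]
  have h1 : ∀ z : Circle, (z : ℂ) * (starRingEnd ℂ) (z : ℂ) = 1 := fun z => by
    rw [Complex.mul_conj]; simp
  have h2 := h1 (θ (e k).2 (cosetCocycle T s (e k).1))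
  change _ = w (e.symm (s⁻¹ • (e k).1, (e k).2)) *
    (starRingEnd ℂ) (v (e.symm (s⁻¹ • (e k).1, (e k).2)))
  linear_combination (w (e.symm (s⁻¹ • (e k).1, (e k).2)) *
    (starRingEnd ℂ) (v (e.symm (s⁻¹ • (e k).1, (e k).2)))) * h2

theorem smul_eq_self_iff_mem [T.Normal] (s : S) (x : S ⧸ T) : s⁻¹ • x = x ↔ s ∈ T := by
  obtain ⟨g, rfl⟩ := QuotientGroup.mk_surjective x
  rw [MulAction.Quotient.smul_mk, QuotientGroup.eq, smul_eq_mul, mul_inv_rev, inv_inv]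
  constructor
  · intro h
    have := (inferInstance : T.Normal).conj_mem _ h g
    simpa [mul_assoc] using this
  · intro h
    have := (inferInstance : T.Normal).conj_mem _ h g⁻¹
    simpa [mul_assoc] using this

theorem cosetCocycle_of_mem [T.Normal] (t : T) (x : S ⧸ T) :
    cosetCocycle T t x = MulAut.conjNormal (x.out⁻¹) t := by
  apply Subtype.ext
  simp only [cosetCocycle, (smul_eq_self_iff_mem (t : S) x).mpr t.2, MulAut.conjNormal_apply,
    inv_inv, mul_assoc]

/-- As `T` is normal, an element outside `T` fixes no coset and its matrix has zero diagonal; an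
element of `T` fixes every coset. -/
theorem character_inducedRep [T.Normal] [Fintype K] [Fintype I] [Finite (S ⧸ T)]
    (θ : I → T →* Circle) (e : K ≃ (S ⧸ T) × I) (s : S) [Decidable (s ∈ T)] :
    (inducedRep θ e).character s = if h : s ∈ T then
      ∑ᶠ x : S ⧸ T, ∑ i, (θ i (MulAut.conjNormal (x.out⁻¹) ⟨s, h⟩) : ℂ) else 0 := by
  classical
  cases nonempty_fintype (S ⧸ T)
  rw [Representation.character, LinearMap.trace_eq_sum_inner _ (EuclideanSpace.basisFun K ℂ)]
  have key : ∀ k, inner ℂ (EuclideanSpace.basisFun K ℂ k)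
      (inducedRep θ e s (EuclideanSpace.basisFun K ℂ k)) =
      if s ∈ T then (θ (e k).2 (cosetCocycle T s (e k).1) : ℂ) else 0 := fun k => by
    rw [EuclideanSpace.basisFun_apply, EuclideanSpace.inner_single_left, inducedRep_apply,
      map_one, one_mul, PiLp.single_apply]
    have : e.symm (s⁻¹ • (e k).1, (e k).2) = k ↔ s⁻¹ • (e k).1 = (e k).1 := by
      rw [Equiv.symm_apply_eq]
      exact ⟨fun h => congrArg Prod.fst h, fun h => Prod.ext h rfl⟩
    simp only [this, smul_eq_self_iff_mem, mul_ite, mul_one, mul_zero]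
  rw [Finset.sum_congr rfl fun k _ => key k]
  split_ifs with h
  · rw [finsum_eq_sum_of_fintype, ← Fintype.sum_prod_type',
      Fintype.sum_equiv e _ (fun y => (θ y.2 (cosetCocycle T s y.1) : ℂ)) fun k => rfl]
    refine Finset.sum_congr rfl fun y _ => ?_
    rw [← cosetCocycle_of_mem ⟨s, h⟩]
  · simp

theorem inducedRep_injective [T.Normal] [Fintype K] [Fintype I] [Nonempty I] [Finite (S ⧸ T)]
    (θ : I → T →* Circle) (hθ : ∀ t, (∀ i, θ i t = 1) → t = 1) (e : K ≃ (S ⧸ T) × I) :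
    Function.Injective (inducedRep θ e) := by
  classical
  rw [injective_iff_map_eq_one]
  intro s hs
  have hsT : s ∈ T := by
    by_contra h
    have h1 := character_inducedRep θ e s
    rw [dif_neg h, Representation.character, hs, ← map_one (inducedRep θ e)] at h1
    have h2 := Representation.char_one (inducedRep θ e)
    rw [Representation.character, h1, finrank_euclideanSpace] at h2
    have : Nonempty K := ⟨e.symm (((1 : S) : S ⧸ T), Classical.arbitrary I)⟩
    exact Fintype.card_ne_zero (α := K) (by exact_mod_cast h2.symm)
  let x : S ⧸ T := ((1 : S) : S ⧸ T)
  have h1 : MulAut.conjNormal (x.out⁻¹) (⟨s, hsT⟩ : T) = 1 := by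
    refine hθ _ fun i => ?_
    -- The coordinate `(x, i)` of the image of the all-ones vector is the value of `θ i`.
    have h2 := congrArg (fun f : Module.End ℂ (EuclideanSpace ℂ K) =>
      f (WithLp.toLp 2 fun _ => 1) (e.symm (x, i))) hs
    simp only [inducedRep_apply, Equiv.apply_symm_apply, mul_one, Module.End.one_apply] at h2
    rw [← cosetCocycle_of_mem]
    exact Circle.coe_eq_one.mp h2
  have h2 : (⟨s, hsT⟩ : T) = 1 := by simpa using h1
  exact congrArg Subtype.val h2

end Induced

/-! ### Local finiteness and assembly -/

section LocallyFinite

/-- The preimage of `T` has finite index, so it is finitely generated; being also abelian and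
torsion, it is finite. -/
theorem finite_of_fg_of_injective {p : ℕ} (hp : p.Prime) {S : Type*} [Group S] {T : Subgroup S}
    [T.Normal] [IsMulCommutative T] [Finite (S ⧸ T)] (hS : IsPGroup p S) {G : Type*} [Group G]
    [Group.FG G] (φ : G →* S) (hφ : Function.Injective φ) : Finite G := by
  have : T.FiniteIndex := Subgroup.finiteIndex_of_finite_quotient
  have : (T.comap φ).FiniteIndex := ⟨fun h => Subgroup.FiniteIndex.index_ne_zero (H := T)
    (Subgroup.index_eq_zero_of_relIndex_eq_zero ((Subgroup.index_comap T φ).symm.trans h))⟩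
  have : IsMulCommutative (T.comap φ) := Subgroup.comap_injective_isMulCommutative T hφ
  have htor : IsMulTorsion (T.comap φ) := fun g => by
    obtain ⟨n, hn⟩ := hS (φ g)
    refine isOfFinOrder_iff_pow_eq_one.mpr ⟨p ^ n, pow_pos hp.pos n, Subtype.ext (hφ ?_)⟩
    rw [Subgroup.coe_pow, map_pow, hn, Subgroup.coe_one, map_one]
  have : Finite (T.comap φ) := CommGroup.finite_of_fg_isMulTorsion _ htor
  exact Finite.of_subgroup_quotient (T.comap φ)

end LocallyFinite

namespace FusionSystem

theorem exists_isIdentityComponent {p : ℕ} (hp : p.Prime) {S : Type*} [Group S]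
    (hS : IsDiscretePToral p S) :
    ∃ (T : Subgroup S) (_ : T.Normal) (_ : IsMulCommutative T) (a : ℕ),
      IsIdentityComponent p (p ^ (a + 1)) T := by
  obtain ⟨k, m, T, hT, ⟨e⟩, hfin, hpg, -⟩ := hS
  have : IsMulCommutative T := ⟨⟨fun a b => e.injective (by rw [map_mul, map_mul, mul_comm])⟩⟩
  have hTor : IsPTorus p T := (isPTorus_pi_pruferGroup hp k).of_mulEquiv e.symm
  have : Fact p.Prime := ⟨hp⟩
  obtain ⟨a, ha⟩ := IsPGroup.iff_card.mp hpg
  -- `p ^ a = |S/T|` would already kill the quotient; the extra factor keeps the exponent divisible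
  -- by `p` when `S = T`.
  refine ⟨T, hT, ‹_›, a, hTor, hpg, hfin, fun x => ?_, hTor.divisible_pow (a + 1)⟩
  rw [← QuotientGroup.eq_one_iff, QuotientGroup.mk_pow, pow_succ, pow_mul, ← ha, pow_card_eq_one',
    one_pow]

/-- A faithful representation of the identity component, a sum of characters, that is invariant
under its `F`-automorphisms and whose character vanishes at all elements conjugate to elements
outside of the identity component. -/
theorem exists_characters_vanishing.{u} {p : ℕ} {S : Type u} [Group S] {T : Subgroup S}
    {F : FusionSystem S} [T.Normal] [IsMulCommutative T] (hp : p.Prime) (hF : F.IsSaturated p) {a : ℕ}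
    (h : IsIdentityComponent p (p ^ (a + 1)) T) :
    ∃ (I : Type u) (_ : Fintype I) (_ : Nonempty I) (θ : I → T →* Circle),
      (∀ w ∈ F.aut T, ∀ t, ∑ i, (θ i (w t) : ℂ) = ∑ i, (θ i t : ℂ)) ∧
      (∀ x ∉ T, ∀ f ∈ F.HomS (Subgroup.zpowers x), ∀ z : T,
        f ⟨x, Subgroup.mem_zpowers x⟩ = z → ∑ i, (θ i z : ℂ) = 0) ∧
      ∀ t, (∀ i, θ i t = 1) → t = 1 := by
  have := finite_aut hp hF h
  -- The trivial subgroup, at `none`, makes the characters faithful; the others make them vanish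
  -- where needed.
  let D : Option (F.aut T × F.aut T) → Subgroup T := fun o => o.elim ⊥ fun x =>
    ((x.1 : MulAut T).toMonoidHom.comp (normEnd (p ^ (a + 1)) (x.2 : MulAut T))).range
  have hfin : {t : T | t ^ (p ^ (a + 1) * p ^ (a + 1)) = 1}.Finite := by
    rw [← pow_add]
    exact h.isPTorus.finite_pow _
  have hD : ∀ o, ∀ d ∈ D o, ∃ d' ∈ D o, d' ^ (p ^ (a + 1) * p ^ (a + 1)) = d := by
    rintro (_ | ⟨w, α⟩) d hd
    · exact ⟨1, one_mem _, by rw [one_pow]; exact (Subgroup.mem_bot.mp hd).symm⟩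
    · obtain ⟨t, rfl⟩ := hd
      obtain ⟨t', rfl⟩ := h.exists_root t
      obtain ⟨t'', rfl⟩ := h.exists_root t'
      exact ⟨_, ⟨t'', rfl⟩, by rw [← map_pow, pow_mul]⟩
  obtain ⟨L, hL, hLD⟩ := exists_finite_family_characters hfin D hD
  have hp' : p ≤ p ^ (a + 1) := Nat.le_self_pow (Nat.succ_ne_zero a) p
  obtain ⟨I, hI, hI', θ, h1, h2, h3⟩ := exists_invariant_characters (F.aut T) hL
    (Q := p ^ (a + 1) * p ^ (a + 1)) (by nlinarith [hp.two_le])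
  refine ⟨I, hI, hI', θ, h1, fun x hx f hf z hz => ?_, fun t ht => ?_⟩
  · obtain ⟨w, hw, α, hα, hzD, hzD'⟩ := exists_notMem_range_of_conj hp hF h hx hf hz
    obtain ⟨χ, hχ, hχz, hχQ⟩ := hLD (some (⟨w, hw⟩, ⟨α, hα⟩)) z hzD hzD'
    exact h2 χ hχ z hχz hχQ
  · refine eq_one_of_forall_character_eq_one h.isPTorus.torsion
      (dvd_mul_of_dvd_left (dvd_pow_self p (Nat.succ_ne_zero a)) (p ^ (a + 1)))
      (fun t ht htQ => ?_) (h3 t ht)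
    obtain ⟨χ, hχ, hne, -⟩ := hLD none t (fun hb => ht (Subgroup.mem_bot.mp hb))
      (Subgroup.mem_bot.mpr htQ)
    exact ⟨χ, hχ, hne⟩

end FusionSystem

/-- A saturated fusion system over a discrete `p`-toral group `S` has a faithful invariant unitary
representation of `S` on some `ℂⁿ`. -/
theorem theorem3p7 {p : ℕ} (hp : p.Prime) {S : Type*} [Group S] (hS : IsDiscretePToral p S)
    (F : FusionSystem S) (hF : F.IsSaturated p) :
    ∃ (n : ℕ) (ρ : Representation ℂ S (EuclideanSpace ℂ (Fin n))),
      (∀ (s : S) (v w : EuclideanSpace ℂ (Fin n)), inner ℂ (ρ s v) (ρ s w) = inner ℂ v w) ∧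
        Function.Injective ρ ∧ F.IsInvariant ρ := by
  classical
  obtain ⟨T, hTn, hTc, a, h⟩ := FusionSystem.exists_isIdentityComponent hp hS
  obtain ⟨I, _, _, θ, hinv, hvan, hfaith⟩ := FusionSystem.exists_characters_vanishing hp hF h
  have := h.finite
  cases nonempty_fintype (S ⧸ T)
  let e : Fin (Fintype.card ((S ⧸ T) × I)) ≃ (S ⧸ T) × I := (Fintype.equivFin _).symm
  have hchar : ∀ s, (inducedRep θ e).character s = if hs : s ∈ T then
      (Nat.card (S ⧸ T) : ℂ) * ∑ i, (θ i ⟨s, hs⟩ : ℂ) else 0 := fun s => by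
    rw [character_inducedRep]
    split_ifs with hs
    · rw [finsum_eq_sum_of_fintype, Finset.sum_congr rfl fun x _ =>
        hinv _ (F.conjNormal_mem_aut (x.out⁻¹)) ⟨s, hs⟩]
      simp [Nat.card_eq_fintype_card]
    · rfl
  have hout : ∀ (P : Subgroup S) (f : P →* S), f ∈ F.HomS P → ∀ x : P, (x : S) ∉ T →
      (inducedRep θ e).character (f x) = 0 := fun P f hf x hx => by
    rw [hchar]
    split_ifs with hfx
    · have hle : Subgroup.zpowers (x : S) ≤ P := by rw [Subgroup.zpowers_le]; exact x.2
      rw [hvan x hx _ (F.restrict_mem_homS hf hle) ⟨f x, hfx⟩ rfl, mul_zero]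
    · rfl
  have hconst : ∀ (P : Subgroup S) (f : P →* S), f ∈ F.HomS P → ∀ x : P,
      (inducedRep θ e).character x = (inducedRep θ e).character (f x) := fun P f hf x => by
    by_cases hx : (x : S) ∈ T
    · by_cases hfx : f x ∈ T
      · have hle : Subgroup.zpowers (x : S) ≤ P := by rw [Subgroup.zpowers_le]; exact x.2
        obtain ⟨w, hw, hwf⟩ := FusionSystem.exists_mulAut_eq hp hF h
          (P := Subgroup.zpowers (x : S)) (by rw [Subgroup.zpowers_le]; exact hx)
          (F.restrict_mem_homS hf hle) (by
            rintro ⟨_, n, rfl⟩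
            have : f (x ^ n) ∈ T := by rw [map_zpow]; exact T.zpow_mem hfx n
            exact this)
        have hwx : w ⟨x, hx⟩ = ⟨f x, hfx⟩ :=
          Subtype.ext (hwf ⟨x, Subgroup.mem_zpowers (x : S)⟩)
        rw [hchar, hchar, dif_pos hx, dif_pos hfx, ← hwx, hinv w hw]
      -- Here `f⁻¹` carries an element outside `T` to `x`, so the character vanishes at `x`.
      · obtain ⟨g, hg, hgf⟩ := F.exists_inverse_mem_homS hf
        have h1 := hout _ g hg ⟨f x, x, rfl⟩ hfx
        rw [hgf] at h1
        rw [h1, hchar, dif_neg hfx]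
    · rw [hout P f hf x hx, hchar, dif_neg hx]
  refine ⟨_, inducedRep θ e, inner_inducedRep θ e, inducedRep_injective θ hfaith e,
    fun P f hf => ?_⟩
  refine Representation.nonempty_equiv_of_char_eq_of_locallyFinite (fun s => ?_)
    (funext fun x => hconst P f hf x)
  have : Group.FG (Subgroup.closure (s : Set P)) := Group.closure_finset_fg s
  exact finite_of_fg_of_injective (T := T) hp (isPGroup_of_isPTorus h.isPTorus h.isPGroup)
    (P.subtype.comp (Subgroup.closure (s : Set P)).subtype)
    (P.subtype_injective.comp (Subgroup.subtype_injective _))
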